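/- Throughout, a partition is a weakly decreasing sequence $\lambda=(\lambda_1,\lambda_2,\dots)$ of non-negative integers with finite sum $|\lambda|$, identified with its Young diagram. For a positive integer $s$, a rim $s$-hook of $\lambda$ is a connected set of $s$ cells of the rim of $\lambda$ whose removal leaves the Young diagram of a partition; an $s$-core is a partition without rim $s$-hooks; $\mathrm{cor}_s\lambda$ is the $s$-core obtained from $\lambda$ by repeatedly removing rim $s$-hooks until none remain, and $\mathrm{wei}_s\lambda=\frac1s(|\lambda|-|\mathrm{cor}_s\lambda|)$ is the number of hooks removed. An $[s{:}t]$-core is a partition $\lambda$ with $\mathrm{wei}_s(\mathrm{cor}_t\lambda)=\mathrm{wei}_s\lambda$. For $r\in\mathbb Z$ let $\beta_r(\lambda)=\{\lambda_i-i+r: i\ge1\}$. For $i\in\mathbb Z/s\mathbb Z$ let $e_i(\lambda)$ be the smallest integer in the class $i$ that is not in $\beta_0(\mathrm{cor}_s\lambda)$, and let $q_i(\lambda)$ be the partition for which $\{(b-a)/s : b\in\beta_0(\lambda)\cap i\}$ is one of the sets $\beta_r(q_i(\lambda))$, $r\in\mathbb Z$, where $a$ is any representative of $i$ (the partition does not depend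 on $a$). The $t$-weighted $s$-quotient of $\lambda$ is the multiset $[(e_i(\lambda)+t\mathbb Z,\ q_i(\lambda)) : i\in\mathbb Z/s\mathbb Z]$ of elements of $\mathbb Z/t\mathbb Z\times\{\text{partitions}\}$. **Proposition.** Let $s$ and $t$ be coprime positive integers, let $\sigma$ be an $s$-core and $\tau$ a $t$-core, and suppose that $\mathrm{cor}_t\sigma=\mathrm{cor}_s\tau$. Then there is a unique partition $\lambda$ with $\mathrm{cor}_s\lambda=\sigma$ and with the same $t$-weighted $s$-quotient as $\tau$. Moreover $\lambda=\sigma\boxplus\tau$; that is, $\lambda$ is an $[s{:}t]$-core with $\mathrm{cor}_s\lambda=\sigma$ and $\mathrm{cor}_t\lambda=\tau$, and it is the only partition with these three properties. -/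

import Mathlib

/-! Partitions are Mathlib's `YoungDiagram`s: `la.rowLen i` is the part with index `i + 1`
(rows and columns are numbered from `0`), `la.card` is the size and `⊥` the empty partition. -/

noncomputable section

namespace GenCore

/-- The rim: the cells `(i, j)` of the diagram for which `(i + 1, j + 1)` is not in the diagram. -/
def rim (la : YoungDiagram) : Finset (ℕ × ℕ) :=
  la.cells.filter fun c => (c.1 + 1, c.2 + 1) ∉ la

/-- `R` is a rim `s`-hook of `la`: a subset of the rim with exactly `s` elements, connected (in the
Hasse graph of `ℕ × ℕ` two cells are adjacent exactly when they share an edge), and such that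
removing it leaves the Young diagram of a partition. -/
def IsRimHook (s : ℕ) (la : YoungDiagram) (R : Finset (ℕ × ℕ)) : Prop :=
  R ⊆ rim la ∧ R.card = s ∧
    ((SimpleGraph.hasse (ℕ × ℕ)).induce (R : Set (ℕ × ℕ))).Connected ∧
    IsLowerSet ((la.cells \ R : Finset (ℕ × ℕ)) : Set (ℕ × ℕ))

/-- `mu` is obtained from `la` by removing one rim `s`-hook. -/
def RemoveHook (s : ℕ) (la mu : YoungDiagram) : Prop :=
  ∃ R : Finset (ℕ × ℕ), IsRimHook s la R ∧ mu.cells = la.cells \ R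

/-- An `s`-core: a partition without rim `s`-hooks. -/
def IsCore (s : ℕ) (la : YoungDiagram) : Prop :=
  ∀ R : Finset (ℕ × ℕ), ¬ IsRimHook s la R

theorem exists_core (s : ℕ) (la : YoungDiagram) :
    ∃ ka : YoungDiagram, Relation.ReflTransGen (RemoveHook s) la ka ∧ IsCore s ka := by
  induction hn : la.card using Nat.strong_induction_on generalizing la with
  | _ n ih =>
    by_cases h : IsCore s la
    · exact ⟨la, Relation.ReflTransGen.refl, h⟩
    · unfold IsCore at h
      push Not at h
      obtain ⟨R, hR⟩ := h
      obtain ⟨c, hc⟩ : R.Nonempty := by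
        obtain ⟨⟨c, hc⟩⟩ := hR.2.2.1.nonempty
        exact ⟨c, hc⟩
      have hlt : (⟨la.cells \ R, hR.2.2.2⟩ : YoungDiagram).card < n := by
        rw [← hn]
        refine Finset.card_lt_card
          ⟨Finset.sdiff_subset, fun hsub => ?_⟩
        have h1 : c ∈ la.cells := (Finset.mem_filter.mp (hR.1 hc)).1
        exact (Finset.mem_sdiff.mp (hsub h1)).2 hc
      obtain ⟨ka, hka, hcore⟩ := ih _ hlt _ rfl
      exact ⟨ka, Relation.ReflTransGen.head ⟨R, hR, rfl⟩ hka, hcore⟩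

/-- The `s`-core of `la`: the result of removing rim `s`-hooks from `la` until none remain. -/
def core (s : ℕ) (la : YoungDiagram) : YoungDiagram :=
  Classical.choose (exists_core s la)

/-- The `s`-weight of `la`: the number `(|la| - |core s la|) / s` of rim `s`-hooks removed on the
way to the `s`-core (the difference is a non-negative multiple of `s`). -/
def weight (s : ℕ) (la : YoungDiagram) : ℕ :=
  (la.card - (core s la).card) / s

/-- An `[s:t]`-core: replacing the partition by its `t`-core does not change the `s`-weight. -/
def IsGenCore (s t : ℕ) (la : YoungDiagram) : Prop :=
  weight s (core t la) = weight s la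

/-- The beta-set `{la_i - i + r : i = 1, 2, …}`. -/
def beta (r : ℤ) (la : YoungDiagram) : Set ℤ :=
  {b | ∃ i : ℕ, b = (la.rowLen i : ℤ) - ((i : ℤ) + 1) + r}

/-- For an arbitrary partition `la` and a residue class `i` modulo `s`, the smallest integer in the
class `i` which is not in the beta-set of the `s`-core of `la`. For `0 < s` the set below is
non-empty and bounded below, so that `sInf` is its least element. -/
def sSetElt (s : ℕ) (la : YoungDiagram) (i : ZMod s) : ℤ :=
  sInf {n : ℤ | (n : ZMod s) = i ∧ n ∉ beta 0 (core s la)}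

theorem exists_rowLen (f : ℕ → ℕ) (hf : Antitone f) (K : ℕ) (hK : f K = 0) :
    ∃ mu : YoungDiagram, ∀ i, mu.rowLen i = f i := by
  classical
  refine ⟨⟨((Finset.range K) ×ˢ (Finset.range (f 0))).filter (fun c => c.2 < f c.1), ?_⟩, ?_⟩
  · rintro ⟨a, b⟩ ⟨c, d⟩ ⟨h1, h2⟩ h
    simp only [Finset.coe_filter, Finset.mem_product, Finset.mem_range, Set.mem_ofPred_eq] at *
    have := hf h1
    refine ⟨⟨?_, ?_⟩, ?_⟩ <;> omega
  · intro i
    refine eq_of_forall_lt_iff fun j => ?_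
    rw [← YoungDiagram.mem_iff_lt_rowLen, ← YoungDiagram.mem_cells]
    simp only [Finset.mem_filter, Finset.mem_product, Finset.mem_range]
    constructor
    · exact fun h => h.2
    · intro h
      have h0 : f i ≤ f 0 := hf (Nat.zero_le i)
      refine ⟨⟨?_, by omega⟩, h⟩
      by_contra hi
      have := hf (not_lt.mp hi)
      omega

/-- A set of integers which is bounded above and whose complement is bounded below is a
beta-set. -/
theorem exists_beta (B : Set ℤ) (h1 : BddAbove B) (h2 : BddBelow Bᶜ) :
    ∃ (mu : YoungDiagram) (r : ℤ), beta r mu = B := by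
  classical
  obtain ⟨M, hM⟩ := h1
  obtain ⟨L, hL⟩ := h2
  let p : ℕ → Prop := fun n => M - (n : ℤ) ∈ B
  obtain ⟨K, hK⟩ : ∃ K : ℕ, ∀ n, K ≤ n → p n := by
    refine ⟨(M - L + 1).toNat, fun n hn => ?_⟩
    by_contra hp
    have := hL (show M - (n : ℤ) ∈ Bᶜ from hp)
    omega
  have hinf : {n : ℕ | p n}.Infinite :=
    Set.infinite_of_forall_exists_gt fun a => ⟨max K (a + 1), hK _ (le_max_left _ _), by omega⟩
  have hcK : Nat.count p K ≤ K := Nat.count_le p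
  obtain ⟨c, hc⟩ : ∃ c, K = Nat.count p K + c := ⟨K - Nat.count p K, by omega⟩
  have hcount : ∀ n, Nat.count p (K + n) = Nat.count p K + n := by
    intro n
    induction n with
    | zero => rfl
    | succ n ih => rw [← add_assoc, Nat.count_succ, ih, if_pos (hK _ (by omega))]; rfl
  have hbig : ∀ i, Nat.count p K ≤ i → Nat.nth p i = i + c := by
    intro i hi
    obtain ⟨d, rfl⟩ := Nat.exists_eq_add_of_le hi
    rw [← hcount d, Nat.nth_count (hK _ (by omega)), hcount]
    omega
  have hmono : ∀ i, Nat.nth p i + 1 ≤ Nat.nth p (i + 1) := fun i =>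
    Nat.nth_strictMono hinf (Nat.lt_succ_self i)
  have hge : ∀ d i, Nat.nth p i + d ≤ Nat.nth p (i + d) := by
    intro d
    induction d with
    | zero => intro i; simp
    | succ d ih => intro i; have := ih i; have := hmono (i + d); rw [← add_assoc i d 1]; omega
  have hle : ∀ i, Nat.nth p i ≤ i + c := by
    intro i
    have h3 := hge (Nat.count p K) i
    have h4 := hbig (i + Nat.count p K) (by omega)
    omega
  obtain ⟨mu, hmu⟩ := exists_rowLen (fun i => i + c - Nat.nth p i)
    (antitone_nat_of_succ_le fun i => by have := hmono i; omega)
    (Nat.count p K) (by simp [hbig _ le_rfl])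
  refine ⟨mu, M - c + 1, ?_⟩
  ext b
  simp only [beta, Set.mem_ofPred_eq, hmu]
  constructor
  · rintro ⟨i, rfl⟩
    have h3 : M - (Nat.nth p i : ℤ) ∈ B := Nat.nth_mem_of_infinite hinf i
    have h4 := hle i
    convert h3 using 1
    rw [Nat.cast_sub h4]
    push_cast
    ring
  · intro hb
    have h3 := hM hb
    have hp : p (M - b).toNat := by
      have h5 : M - ((M - b).toNat : ℤ) = b := by omega
      simpa only [p, h5] using hb
    refine ⟨Nat.count p (M - b).toNat, ?_⟩
    have h4 := hle (Nat.count p (M - b).toNat)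
    rw [Nat.cast_sub h4, Nat.nth_count hp]
    push_cast
    omega

theorem exists_quo (s : ℕ) [NeZero s] (la : YoungDiagram) (a : ℤ) :
    ∃ (mu : YoungDiagram) (r : ℤ), beta r mu = {x : ℤ | a + (s : ℤ) * x ∈ beta 0 la} := by
  have hs : (1 : ℤ) ≤ s := by exact_mod_cast Nat.one_le_iff_ne_zero.mpr (NeZero.ne s)
  refine exists_beta _ ⟨|a| + la.rowLen 0, ?_⟩ ⟨-|a| - la.colLen 0 - 1, ?_⟩
  · rintro x ⟨i, hi⟩
    have h1 : la.rowLen i ≤ la.rowLen 0 := la.rowLen_anti 0 i (Nat.zero_le i)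
    have h2 := neg_abs_le a
    by_contra hx
    push Not at hx
    have h3 : 0 ≤ x := by have := abs_nonneg a; omega
    nlinarith
  · intro x hx
    by_contra hlt
    push Not at hlt
    apply hx
    have h2 := le_abs_self a
    have h4 := abs_nonneg a
    have h3 : a + (s : ℤ) * x < -(la.colLen 0 : ℤ) - 1 := by nlinarith
    refine ⟨(-(a + (s : ℤ) * x) - 1).toNat, ?_⟩
    have h5 : la.rowLen (-(a + (s : ℤ) * x) - 1).toNat = 0 := by
      by_contra hne
      have h6 : ((-(a + (s : ℤ) * x) - 1).toNat, 0) ∈ la :=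
        YoungDiagram.mem_iff_lt_rowLen.mpr (Nat.pos_of_ne_zero hne)
      have h7 := YoungDiagram.mem_iff_lt_colLen.mp h6
      omega
    rw [h5]
    push_cast
    omega

/-- The component of the `s`-quotient of `la` at the residue class `j` modulo `s`: with
`a = j.val`, a representative of `j`, it is the partition for which
`{(b - a) / s : b ∈ beta 0 la, b ∈ j}` is a beta-set. -/
def quo (s : ℕ) [NeZero s] (la : YoungDiagram) (j : ZMod s) : YoungDiagram :=
  Classical.choose (exists_quo s la (j.val : ℤ))

/-- The `t`-weighted `s`-quotient of `la`: the multiset of the pairs formed by the element of the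
`s`-set of `la` in the class `i`, reduced modulo `t`, and the component at `i` of the `s`-quotient,
as `i` runs over the residue classes modulo `s`. -/
def weightedQuotient (s t : ℕ) [NeZero s] (la : YoungDiagram) :
    Multiset (ZMod t × YoungDiagram) :=
  (Finset.univ : Finset (ZMod s)).val.map fun i => ((sSetElt s la i : ZMod t), quo s la i)

/-- `la = σ ⊞ τ`: `la` is the unique `[s:t]`-core with `s`-core `σ` and `t`-core `τ`. -/
def IsBoxplus (s t : ℕ) (σ τ la : YoungDiagram) : Prop :=
  (IsGenCore s t la ∧ core s la = σ ∧ core t la = τ) ∧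
    ∀ mu : YoungDiagram, IsGenCore s t mu → core s mu = σ → core t mu = τ → mu = la

end GenCore

end

/-! A partition is encoded by its beta-set, a Maya diagram of charge `0`, and Maya diagrams are
measured by regularised sums `msum f`. Removing a rim `s`-hook moves one bead from `b` to `b - s`,
so `msum f` is unchanged for every `s`-periodic `f`. Taking indicators of residue classes for `f`
gives the charges of the `s` runners, recorded as markers `elt`. These markers determine the
`s`-core, which consists of all `x` below the marker of their class. The components of the
`s`-quotient are the runners recentred at their markers (`frame`), and the `s`-weight is half the
sum of `dwt` over the runners.

The heart is `IsGenCore.weightedQuotient_core`: an `[s:t]`-core has the same weighted quotient as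
its `t`-core. Take runners `X` and `Y` of the classes `a` and `a + t`, and move every bead of `Y`
whose position `t` below is vacant down to that position. This replaces `X, Y` by `X ∪ Y, X ∩ Y`,
keeps the `t`-core, and lowers the `s`-weight by the product of `c(X ∪ Y) - c(X)` and `c(X ∪ Y) -
c(Y)`, where `c` is the charge (`dweight_fold`). The product is non-negative and vanishes only if
`X` and `Y` are nested. If a bead really moved, nesting means `X ⊆ Y`: the two runners just trade
places, with displacements `±t`, and the weighted quotient survives (`elt_frame_fold`). Iterating
down to the `t`-core shows that the weight never increases and that equality preserves the weighted
quotient.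

Existence: put `κ = cor_t σ = cor_s τ`. Both `σ` and `κ` are `s`-cores, so `σ` is an `[s:t]`-core
and its markers match those of `κ` modulo `t` up to a permutation. Displacing whole runners by the
differences, all multiples of `t`, is a permutation of the integers carrying `σ` to `κ`; pulling `τ`
back along it gives `λ`. It has the runners of `τ` and the markers of `σ`, and comparing
`t`-periodic sums shows that its `t`-core is `τ`.

Uniqueness: in a `t`-core, markers congruent modulo `t` carry equal frames (`IsCore.frame_eq`). The
weighted quotient therefore makes the frame a function of the marker modulo `t`, and the `s`-core
supplies the markers. For the last claim, any competing `[s:t]`-core inherits the weighted quotient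
of its `t`-core `τ`. -/

noncomputable section

namespace GenCore

/-! ### Maya diagrams, regularised sums and charge. -/

/-- The integer-valued indicator function of a set of integers. -/
def ind (B : Set ℤ) (x : ℤ) : ℤ := B.indicator 1 x

theorem ind_of_mem {B : Set ℤ} {x : ℤ} (h : x ∈ B) : ind B x = 1 := by simp [ind, h]

theorem ind_of_notMem {B : Set ℤ} {x : ℤ} (h : x ∉ B) : ind B x = 0 := by simp [ind, h]

theorem ind_congr {A B : Set ℤ} {x y : ℤ} (h : x ∈ A ↔ y ∈ B) : ind A x = ind B y := by
  by_cases hx : x ∈ A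
  · rw [ind_of_mem hx, ind_of_mem (h.1 hx)]
  · rw [ind_of_notMem hx, ind_of_notMem (fun hy => hx (h.2 hy))]

/-- A Maya diagram: a set of integers that contains all sufficiently small integers and no
sufficiently large one. -/
def IsMaya (B : Set ℤ) : Prop := BddAbove B ∧ BddBelow Bᶜ

theorem isMaya_iff {B : Set ℤ} :
    IsMaya B ↔ ∃ N : ℤ, ∀ x, (N ≤ x → x ∉ B) ∧ (x ≤ -N → x ∈ B) := by
  constructor
  · rintro ⟨⟨M, hM⟩, ⟨L, hL⟩⟩
    refine ⟨max (M + 1) (-L + 1), fun x => ⟨fun h hx => ?_, fun h => ?_⟩⟩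
    · have := hM hx; omega
    · by_contra hx
      have := hL hx; omega
  · rintro ⟨N, hN⟩
    refine ⟨⟨N, fun x hx => ?_⟩, ⟨-N, fun x hx => ?_⟩⟩
    · by_contra h; exact (hN x).1 (by omega) hx
    · by_contra h; exact hx ((hN x).2 (by omega))

theorem isMaya_Iio (n : ℤ) : IsMaya (Set.Iio n) :=
  isMaya_iff.2 ⟨|n| + 1, fun x => by
    have := abs_le.1 (le_refl |n|)
    simp only [Set.mem_Iio]; omega⟩

theorem IsMaya.union {A B : Set ℤ} (hA : IsMaya A) (hB : IsMaya B) : IsMaya (A ∪ B) :=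
  ⟨hA.1.union hB.1, hA.2.mono (by simp)⟩

theorem IsMaya.inter {A B : Set ℤ} (hA : IsMaya A) (hB : IsMaya B) : IsMaya (A ∩ B) :=
  ⟨hA.1.mono (by simp), by rw [Set.compl_inter]; exact hA.2.union hB.2⟩

/-- A set that agrees with Maya diagrams up to a bounded displacement is a Maya diagram. -/
theorem IsMaya.of_displacement {A B : Set ℤ} (hB : IsMaya B) (D : ℤ)
    (h : ∀ x, ∃ y z, |y - x| ≤ D ∧ |z - x| ≤ D ∧ (y ∈ B → x ∈ A) ∧ (x ∈ A → z ∈ B)) : IsMaya A := by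
  obtain ⟨N, hN⟩ := isMaya_iff.1 hB
  refine isMaya_iff.2 ⟨N + D, fun x => ?_⟩
  obtain ⟨y, z, hy, hz, h1, h2⟩ := h x
  have := abs_le.1 hy
  have := abs_le.1 hz
  exact ⟨fun hx hA => (hN z).1 (by omega) (h2 hA), fun hx => h1 ((hN y).2 (by omega))⟩

theorem IsMaya.shift {B : Set ℤ} (hB : IsMaya B) (k : ℤ) : IsMaya {x | x + k ∈ B} :=
  hB.of_displacement |k| fun x => ⟨x + k, x + k, by simp, by simp, id, id⟩

theorem finite_support_of_bounded {h : ℤ → ℤ} (N : ℤ) (hN : ∀ x, h x ≠ 0 → |x| ≤ N) :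
    (Function.support h).Finite :=
  (Set.finite_Icc (-N) N).subset fun x hx => abs_le.1 (hN x hx)

theorem finite_support_ind_sub {A B : Set ℤ} (hA : IsMaya A) (hB : IsMaya B) :
    (Function.support fun x => ind A x - ind B x).Finite := by
  obtain ⟨N, hN⟩ := isMaya_iff.1 hA
  obtain ⟨M, hM⟩ := isMaya_iff.1 hB
  refine finite_support_of_bounded (max N M) fun x hx => ?_
  by_contra hlt
  apply hx
  rcases le_or_gt 0 x with h0 | h0
  · rw [abs_of_nonneg h0] at hlt
    rw [ind_of_notMem ((hN x).1 (by omega)), ind_of_notMem ((hM x).1 (by omega)), sub_zero]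
  · rw [abs_of_neg h0] at hlt
    rw [ind_of_mem ((hN x).2 (by omega)), ind_of_mem ((hM x).2 (by omega)), sub_self]

theorem finite_support_mul {h : ℤ → ℤ} (hh : (Function.support h).Finite) (f : ℤ → ℤ) :
    (Function.support fun x => h x * f x).Finite :=
  hh.subset fun x hx hx0 => hx (by simp [hx0])

/-- The sum of `f` over the Maya diagram `B`, normalised by the sum over the negative integers. -/
def msum (f : ℤ → ℤ) (B : Set ℤ) : ℤ := ∑ᶠ x, (ind B x - ind (Set.Iio 0) x) * f x

theorem msum_sub_msum {A B : Set ℤ} (hA : IsMaya A) (hB : IsMaya B) (f : ℤ → ℤ) :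
    msum f A - msum f B = ∑ᶠ x, (ind A x - ind B x) * f x := by
  rw [msum, msum, ← finsum_sub_distrib
    (finite_support_mul (finite_support_ind_sub hA (isMaya_Iio 0)) f)
    (finite_support_mul (finite_support_ind_sub hB (isMaya_Iio 0)) f)]
  exact finsum_congr fun x => by ring

theorem msum_Iio_zero (f : ℤ → ℤ) : msum f (Set.Iio 0) = 0 := by simp [msum]

theorem msum_union_add_inter {A B : Set ℤ} (hA : IsMaya A) (hB : IsMaya B) (f : ℤ → ℤ) :
    msum f (A ∪ B) + msum f (A ∩ B) = msum f A + msum f B := by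
  have h : msum f (A ∪ B) - msum f A = msum f B - msum f (A ∩ B) := by
    rw [msum_sub_msum (hA.union hB) hA, msum_sub_msum hB (hA.inter hB)]
    refine finsum_congr fun x => ?_
    congr 1
    by_cases h1 : x ∈ A <;> by_cases h2 : x ∈ B <;> simp [ind, h1, h2]
  linarith

/-- The effect on `msum` of moving beads down by `t`: the beads arrive at the support of `h`. -/
theorem msum_move {A B : Set ℤ} (hA : IsMaya A) (hB : IsMaya B) (t : ℤ) (h : ℤ → ℤ)
    (hh : (Function.support h).Finite) (hAB : ∀ x, ind A x = ind B x + h x - h (x - t))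
    (f : ℤ → ℤ) : msum f A = msum f B + ∑ᶠ x, h x * (f x - f (x + t)) := by
  have h1 : ∑ᶠ x, h (x - t) * f x = ∑ᶠ x, h x * f (x + t) := by
    rw [← finsum_comp_equiv (Equiv.addRight t)]
    simp
  have h2 : (Function.support fun x => h (x - t)).Finite := by
    refine (hh.image (· + t)).subset fun x hx => ⟨x - t, hx, by simp⟩
  have h3 := msum_sub_msum hA hB f
  have h4 : ∑ᶠ x, (ind A x - ind B x) * f x = ∑ᶠ x, (h x * f x - h (x - t) * f x) :=
    finsum_congr fun x => by rw [hAB]; ring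
  rw [h4, finsum_sub_distrib (finite_support_mul hh f) (finite_support_mul h2 f), h1,
    ← finsum_sub_distrib (finite_support_mul hh f) (finite_support_mul hh _)] at h3
  rw [finsum_congr fun x => (mul_sub (h x) (f x) (f (x + t)))]
  linarith

theorem msum_move_single {A B : Set ℤ} (hA : IsMaya A) (hB : IsMaya B) (b c : ℤ)
    (hAB : ∀ x, ind A x = ind B x + ind {c} x - ind {b} x)
    (f : ℤ → ℤ) : msum f A = msum f B + f c - f b := by
  have hf : (Function.support fun x => ind {c} x).Finite :=
    (Set.finite_singleton c).subset fun x hx => by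
      by_contra h; exact hx (ind_of_notMem h)
  rw [msum_move hA hB (b - c) (ind {c}) hf fun x => by
    rw [hAB, ind_congr (A := {b}) (B := {c}) (y := x - (b - c))]
    simp only [Set.mem_singleton_iff]; omega]
  rw [finsum_eq_single _ c fun x hx => by rw [ind_of_notMem (by simpa using hx), zero_mul],
    ind_of_mem (Set.mem_singleton c)]
  rw [show c + (b - c) = b by ring]; ring

theorem msum_le_of_subset {A B : Set ℤ} (hA : IsMaya A) (hB : IsMaya B) (h : A ⊆ B) :
    msum 1 A ≤ msum 1 B := by
  have h1 := msum_sub_msum hB hA 1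
  have h2 : 0 ≤ ∑ᶠ x, (ind B x - ind A x) * (1 : ℤ → ℤ) x := finsum_nonneg fun x => by
    by_cases h1 : x ∈ A
    · simp [ind, h1, h h1]
    · by_cases h2 : x ∈ B <;> simp [ind, h1, h2]
  linarith

/-- For nested Maya diagrams the difference of charges counts the points of `B \ A`. -/
theorem eq_of_subset_of_msum_eq {A B : Set ℤ} (hA : IsMaya A) (hB : IsMaya B) (h : A ⊆ B)
    (hc : msum 1 B = msum 1 A) : A = B := by
  refine h.antisymm fun y hy => ?_
  by_contra hyA
  have h1 := msum_sub_msum hB hA 1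
  have h2 : 0 < ∑ᶠ x, (ind B x - ind A x) * (1 : ℤ → ℤ) x :=
    finsum_pos (fun x => by
      by_cases h1 : x ∈ A
      · simp [ind, h1, h h1]
      · by_cases h2 : x ∈ B <;> simp [ind, h1, h2])
      ⟨y, by simp [ind, hy, hyA]⟩ (finite_support_mul (finite_support_ind_sub hB hA) _)
  linarith

theorem msum_Iio_succ (f : ℤ → ℤ) (n : ℤ) :
    msum f (Set.Iio (n + 1)) = msum f (Set.Iio n) + f n := by
  have h := msum_sub_msum (isMaya_Iio (n + 1)) (isMaya_Iio n) f
  rw [finsum_eq_single _ n fun x hx => by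
    rw [ind_congr (A := Set.Iio (n + 1)) (B := Set.Iio n) (y := x)
      (by simp only [Set.mem_Iio]; omega)]; simp] at h
  rw [ind_of_mem (by simp), ind_of_notMem (by simp)] at h
  linarith

theorem msum_one_Iio (n : ℤ) : msum 1 (Set.Iio n) = n := by
  induction n with
  | zero => exact msum_Iio_zero 1
  | succ n ih => rw [msum_Iio_succ, ih]; rfl
  | pred n ih =>
    have := msum_Iio_succ 1 (-(n : ℤ) - 1)
    rw [sub_add_cancel, ih] at this
    simp only [Pi.one_apply] at this; linarith

theorem msum_id_Iio (n : ℤ) : 2 * msum id (Set.Iio n) = n * (n - 1) := by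
  induction n with
  | zero => simp [msum_Iio_zero id]
  | succ n ih => rw [msum_Iio_succ, mul_add, ih]; simp only [id]; ring
  | pred n ih =>
    have := msum_Iio_succ id (-(n : ℤ) - 1)
    rw [sub_add_cancel] at this
    rw [this] at ih
    simp only [id] at ih; linarith

theorem msum_shift {B : Set ℤ} (hB : IsMaya B) (k : ℤ) (f : ℤ → ℤ) :
    msum f {x | x + k ∈ B} = msum (fun x => f (x - k)) B + msum f (Set.Iio (-k)) := by
  have h := msum_sub_msum (hB.shift k) (isMaya_Iio (-k)) f
  have h2 : ∑ᶠ x, (ind {x | x + k ∈ B} x - ind (Set.Iio (-k)) x) * f x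
      = msum (fun x => f (x - k)) B := by
    rw [msum]
    refine Eq.trans (finsum_congr fun x => ?_) (finsum_comp_equiv (Equiv.addRight k))
    rw [ind_congr (A := {x | x + k ∈ B}) (B := B) (y := x + k) Iff.rfl,
      ind_congr (A := Set.Iio (-k)) (B := Set.Iio 0) (y := x + k)
      (by simp only [Set.mem_Iio]; omega)]
    simp
  linarith

theorem msum_one_shift {B : Set ℤ} (hB : IsMaya B) (k : ℤ) :
    msum 1 {x | x + k ∈ B} = msum 1 B - k := by
  rw [msum_shift hB, msum_one_Iio]; rfl

/-- Twice the number of unit moves that lead from a Maya diagram to the set of all integers below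
its charge. -/
def dwt (X : Set ℤ) : ℤ := 2 * msum id X - msum 1 X * (msum 1 X - 1)

theorem dwt_Iio (n : ℤ) : dwt (Set.Iio n) = 0 := by
  rw [dwt, msum_id_Iio, msum_one_Iio, sub_self]

theorem dwt_shift {B : Set ℤ} (hB : IsMaya B) (k : ℤ) : dwt {x | x + k ∈ B} = dwt B := by
  have h1 : msum (fun x => id (x - k)) B = msum id B - k * msum 1 B := by
    have hf := finite_support_ind_sub hB (isMaya_Iio 0)
    rw [msum, msum, msum, mul_finsum' _ k (finite_support_mul hf _),
      ← finsum_sub_distrib (finite_support_mul hf _)]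
    · exact finsum_congr fun x => by simp; ring
    · exact (finite_support_mul hf 1).subset fun x hx hx0 => hx (by simpa using Or.inr hx0)
  rw [dwt, dwt, msum_one_shift hB, msum_shift hB, h1, mul_add, msum_id_Iio]
  ring

/-- Regularised sums are modular for union and intersection, so only the quadratic charge terms fail
to cancel. Their defect factors into the product that controls the change of weight under folding.
-/
theorem dwt_union_add_inter {A B : Set ℤ} (hA : IsMaya A) (hB : IsMaya B) :
    dwt A + dwt B = dwt (A ∪ B) + dwt (A ∩ B) +
      2 * ((msum 1 (A ∪ B) - msum 1 A) * (msum 1 (A ∪ B) - msum 1 B)) := by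
  have h1 := msum_union_add_inter hA hB 1
  have h2 := msum_union_add_inter hA hB id
  have h3 : msum 1 (A ∩ B) = msum 1 A + msum 1 B - msum 1 (A ∪ B) := by linarith
  have h4 : msum id (A ∩ B) = msum id A + msum id B - msum id (A ∪ B) := by linarith
  simp only [dwt, h3, h4]
  ring

/-- A Maya diagram closed under `x ↦ x - 1` is the set of all integers below its charge. -/
theorem eq_Iio_of_closed {X : Set ℤ} (hX : IsMaya X) (h : ∀ x ∈ X, x - 1 ∈ X) :
    X = Set.Iio (msum 1 X) := by
  obtain ⟨n, hn⟩ : ∃ n, X = Set.Iio n := by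
    obtain ⟨N, hN⟩ := isMaya_iff.1 hX
    obtain ⟨m, hm, hmax⟩ := Int.exists_greatest_of_bdd (P := (· ∈ X))
      ⟨N, fun z hz => by by_contra hlt; exact (hN z).1 (by omega) hz⟩ ⟨-N, (hN _).2 le_rfl⟩
    have hlow : ∀ k : ℕ, m - k ∈ X := by
      intro k
      induction k with
      | zero => simpa using hm
      | succ k ih => have := h _ ih; rwa [sub_sub] at this; 
    refine ⟨m + 1, Set.ext fun x => ⟨fun hx => ?_, fun hx => ?_⟩⟩
    · have := hmax x hx; simp only [Set.mem_Iio]; omega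
    · have h1 := hlow (m - x).toNat
      simp only [Set.mem_Iio] at hx
      rwa [show m - ((m - x).toNat : ℤ) = x by omega] at h1
  rw [hn, msum_one_Iio]

/-! ### Rim hooks as moves of a single bead. -/

/-- The `i`-th largest element of `beta 0 la`. -/
def bead (la : YoungDiagram) (i : ℕ) : ℤ := (la.rowLen i : ℤ) - ((i : ℤ) + 1)

theorem bead_lt (la : YoungDiagram) {i j : ℕ} (h : i < j) : bead la j < bead la i := by
  have := la.rowLen_anti i j h.le
  simp only [bead]; omega

theorem bead_injective (la : YoungDiagram) : Function.Injective (bead la) :=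
  (show StrictAnti (bead la) from fun _ _ h => bead_lt la h).injective

theorem mem_beta_zero {la : YoungDiagram} {b : ℤ} : b ∈ beta 0 la ↔ ∃ i, b = bead la i := by
  simp [beta, bead]

theorem rowLen_eq_zero {la : YoungDiagram} {i : ℕ} (h : la.colLen 0 ≤ i) : la.rowLen i = 0 := by
  by_contra hne
  have := YoungDiagram.mem_iff_lt_colLen.1
    (YoungDiagram.mem_iff_lt_rowLen.2 (Nat.pos_of_ne_zero hne))
  omega

theorem ext_rowLen {la mu : YoungDiagram} (h : ∀ i, la.rowLen i = mu.rowLen i) : la = mu := by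
  ext ⟨i, j⟩
  simp only [YoungDiagram.mem_cells, YoungDiagram.mem_iff_lt_rowLen, h]

theorem card_eq_sum_rowLen (la : YoungDiagram) {N : ℕ} (hN : la.colLen 0 ≤ N) :
    la.card = ∑ j ∈ Finset.range N, la.rowLen j := by
  rw [YoungDiagram.card, Finset.card_eq_sum_card_fiberwise (f := Prod.fst) (t := Finset.range N)]
  · exact Finset.sum_congr rfl fun j _ => (la.rowLen_eq_card (i := j)).symm
  · rintro ⟨i, j⟩ h
    have h1 : (i, j) ∈ la := h
    have h2 := YoungDiagram.mem_iff_lt_colLen.1 h1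
    have h3 := la.colLen_anti 0 j (Nat.zero_le j)
    simp only [Finset.coe_range, Set.mem_Iio]
    omega

/-- `mu` arises from `la` by removing a strip along the rim from row `i` to row `k`. -/
structure IsStrip (la mu : YoungDiagram) (i k : ℕ) : Prop where
  le : i ≤ k
  above : ∀ j, j < i → mu.rowLen j = la.rowLen j
  below : ∀ j, k < j → mu.rowLen j = la.rowLen j
  shift : ∀ j, i ≤ j → j < k → mu.rowLen j + 1 = la.rowLen (j + 1)
  lt : mu.rowLen k < la.rowLen k

/-- The row differences telescope: for `i ≤ j < k` the difference in row `j` is `bead la j - bead la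
(j + 1)`. -/
theorem IsStrip.card {la mu : YoungDiagram} {i k : ℕ} (h : IsStrip la mu i k) :
    (la.card : ℤ) - mu.card = bead la i - bead mu k := by
  have key : ∀ n : ℕ,
      ((∑ j ∈ Finset.range n, la.rowLen j : ℕ) : ℤ) - (∑ j ∈ Finset.range n, mu.rowLen j : ℕ) =
        if n ≤ i then 0 else if n ≤ k then bead la i - bead la n else bead la i - bead mu k := by
    intro n
    induction n with
    | zero => simp
    | succ n ih =>
      rw [Finset.sum_range_succ, Finset.sum_range_succ]
      have h1 := h.le
      have h2 := h.above n
      have h3 := h.below n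
      have h4 := h.shift n
      rcases lt_trichotomy n k with h6 | h6 | h6
      · rcases lt_trichotomy n i with h5 | h5 | h5
        · simp only [bead] at *
          split_ifs at * <;> push_cast at * <;> omega
        · subst h5
          simp only [bead] at *
          split_ifs at * <;> push_cast at * <;> omega
        · simp only [bead] at *
          split_ifs at * <;> push_cast at * <;> omega
      · subst h6
        rcases h1.lt_or_eq with h5 | h5
        · simp only [bead] at *
          split_ifs at * <;> push_cast at * <;> omega
        · subst h5
          simp only [bead] at *
          split_ifs at * <;> push_cast at * <;> omega
      · simp only [bead] at *
        split_ifs at * <;> push_cast at * <;> omega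
  have h1 := key (la.colLen 0 + mu.colLen 0 + k + 1)
  rw [← card_eq_sum_rowLen la (by omega), ← card_eq_sum_rowLen mu (by omega), if_neg, if_neg] at h1
  · exact h1
  · omega
  · have := h.le; omega

/-- The new bead lies strictly between the consecutive old beads with indices `k + 1` and `k`. -/
theorem IsStrip.bead_notMem {la mu : YoungDiagram} {i k : ℕ} (h : IsStrip la mu i k) :
    bead mu k ∉ beta 0 la := by
  rw [mem_beta_zero]
  rintro ⟨j, hj⟩
  have hlt := h.lt
  rcases le_or_gt j k with h1 | h1
  · rcases h1.lt_or_eq with h1 | rfl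
    · have := bead_lt la h1
      simp only [bead] at *; omega
    · simp only [bead] at *; omega
  · have h2 := bead_lt mu h1
    have h3 := h.below j h1
    simp only [bead] at *; omega

theorem IsStrip.mem_beta {la mu : YoungDiagram} {i k : ℕ} (h : IsStrip la mu i k) (x : ℤ) :
    x ∈ beta 0 mu ↔ x = bead mu k ∨ (x ∈ beta 0 la ∧ x ≠ bead la i) := by
  have hbead : ∀ j, i ≤ j → j < k → bead mu j = bead la (j + 1) := fun j h1 h2 => by
    have := h.shift j h1 h2
    simp only [bead]; push_cast; omega
  have hab : ∀ j, j < i → bead mu j = bead la j := fun j h1 => by rw [bead, h.above j h1, bead]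
  have hbe : ∀ j, k < j → bead mu j = bead la j := fun j h1 => by rw [bead, h.below j h1, bead]
  have hle := h.le
  rw [mem_beta_zero, mem_beta_zero]
  constructor
  · rintro ⟨j, rfl⟩
    rcases lt_or_ge j i with h1 | h1
    · exact Or.inr ⟨⟨j, hab j h1⟩, by rw [hab j h1]; exact (bead_injective la).ne (by omega)⟩
    · rcases lt_trichotomy j k with h2 | rfl | h2
      · exact Or.inr ⟨⟨j + 1, hbead j h1 h2⟩, by
          rw [hbead j h1 h2]; exact (bead_injective la).ne (by omega)⟩
      · exact Or.inl rfl
      · exact Or.inr ⟨⟨j, hbe j h2⟩, by rw [hbe j h2]; exact (bead_injective la).ne (by omega)⟩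
  · rintro (rfl | ⟨⟨j, rfl⟩, hne⟩)
    · exact ⟨k, rfl⟩
    · rcases lt_trichotomy j i with h1 | rfl | h1
      · exact ⟨j, (hab j h1).symm⟩
      · exact absurd rfl hne
      · rcases le_or_gt j k with h2 | h2
        · refine ⟨j - 1, ?_⟩
          rw [hbead (j - 1) (by omega) (by omega), Nat.sub_add_cancel (by omega)]
        · exact ⟨j, (hbe j h2).symm⟩

/-- Take `i` and `k` to be the first and last rows that meet the hook. Between them, connectedness
and the rim condition bound `la.rowLen (j + 1)` from both sides by `mu.rowLen j + 1`. -/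
theorem exists_strip_of_removeHook {s : ℕ} {la mu : YoungDiagram} (h : RemoveHook s la mu) :
    ∃ i k, IsStrip la mu i k := by
  obtain ⟨R, ⟨hrim, -, hconn, -⟩, hmu⟩ := h
  have hmem : ∀ a c, (a, c) ∈ R ↔ mu.rowLen a ≤ c ∧ c < la.rowLen a := by
    intro a c
    have h1 : (a, c) ∈ mu ↔ (a, c) ∈ la ∧ (a, c) ∉ R := by
      rw [← YoungDiagram.mem_cells, hmu, Finset.mem_sdiff, YoungDiagram.mem_cells]
    have h2 : (a, c) ∈ R → (a, c) ∈ la := fun h => (Finset.mem_filter.1 (hrim h)).1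
    rw [YoungDiagram.mem_iff_lt_rowLen, YoungDiagram.mem_iff_lt_rowLen] at h1
    rw [YoungDiagram.mem_iff_lt_rowLen] at h2
    constructor
    · intro h
      have := h2 h
      exact ⟨by by_contra h3; exact (h1.1 (by omega)).2 h, this⟩
    · rintro ⟨h3, h4⟩
      by_contra h5
      have := h1.2 ⟨h4, h5⟩
      omega
  have hle : ∀ a, mu.rowLen a ≤ la.rowLen a := fun a => by
    by_contra hlt
    have h1 : (a, la.rowLen a) ∈ mu := YoungDiagram.mem_iff_lt_rowLen.2 (by omega)
    rw [← YoungDiagram.mem_cells, hmu, Finset.mem_sdiff, YoungDiagram.mem_cells,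
      YoungDiagram.mem_iff_lt_rowLen] at h1
    exact lt_irrefl _ h1.1
  have hne : (R.image Prod.fst).Nonempty := by
    obtain ⟨⟨c, hc⟩⟩ := hconn.nonempty
    exact ⟨c.1, Finset.mem_image_of_mem _ hc⟩
  set i := (R.image Prod.fst).min' hne with hi
  set k := (R.image Prod.fst).max' hne with hk
  have hrow : ∀ a, a ∈ R.image Prod.fst ↔ mu.rowLen a < la.rowLen a := by
    intro a
    rw [Finset.mem_image]
    constructor
    · rintro ⟨⟨a', c⟩, h, rfl⟩
      have := (hmem _ _).1 h
      simp only; omega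
    · exact fun h => ⟨(a, mu.rowLen a), (hmem _ _).2 ⟨le_rfl, h⟩, rfl⟩
  have hin : ∀ a, mu.rowLen a < la.rowLen a → i ≤ a ∧ a ≤ k := fun a ha =>
    ⟨Finset.min'_le _ _ ((hrow a).2 ha), Finset.le_max' _ _ ((hrow a).2 ha)⟩
  have hiR := (hrow i).1 (Finset.min'_mem _ hne)
  have hkR := (hrow k).1 (Finset.max'_mem _ hne)
  refine ⟨i, k, (hin i hiR).2, fun j hj => ?_, fun j hj => ?_, fun j hij hjk => ?_, hkR⟩
  · have := hle j
    by_contra h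
    have := (hin j (by omega)).1; omega
  · have := hle j
    by_contra h
    have := (hin j (by omega)).2; omega
  · let S : Set (R : Set (ℕ × ℕ)) := {c | c.1.1 ≤ j}
    obtain ⟨p⟩ := hconn.preconnected ⟨(i, mu.rowLen i), (hmem _ _).2 ⟨le_rfl, hiR⟩⟩
      ⟨(k, mu.rowLen k), (hmem _ _).2 ⟨le_rfl, hkR⟩⟩
    -- A path from row `i` to row `k` must cross from row `j` to row `j + 1` along a vertical edge,
    -- so the hook has cells of both rows in one column.
    obtain ⟨d, -, hd1, hd2⟩ := p.exists_boundary_dart S hij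
      (by simp only [S, Set.mem_ofPred_eq]; omega)
    have hadj := d.adj
    obtain ⟨⟨⟨⟨a, c⟩, hac⟩, ⟨⟨a', c'⟩, hac'⟩⟩, _⟩ := d
    simp only [S, Set.mem_ofPred_eq, not_le] at hd1 hd2
    simp only [SimpleGraph.comap_adj, Function.Embedding.subtype_apply, SimpleGraph.hasse_adj,
      Prod.mk_covBy_mk_iff, Nat.covBy_iff_add_one_eq] at hadj
    have h1 := (hmem a c).1 hac
    have h2 := (hmem a' c').1 hac'
    obtain ⟨rfl, rfl, rfl⟩ : a = j ∧ a' = a + 1 ∧ c' = c := by omega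
    have h3 : (a, mu.rowLen a) ∈ R := (hmem _ _).2 ⟨le_rfl, by omega⟩
    have h4 := (Finset.mem_filter.1 (hrim h3)).2
    rw [YoungDiagram.mem_iff_lt_rowLen] at h4
    simp only at h4
    omega

theorem card_of_removeHook {s : ℕ} {la mu : YoungDiagram} (h : RemoveHook s la mu) :
    la.card = mu.card + s := by
  obtain ⟨R, ⟨hrim, hs, -, -⟩, hmu⟩ := h
  have h1 : R ⊆ la.cells := hrim.trans (Finset.filter_subset _ _)
  have h2 := Finset.card_sdiff_add_card_eq_card h1
  rw [← hmu, hs] at h2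
  exact h2.symm

/-- Removing a rim `s`-hook moves one bead down by `s`. -/
theorem exists_bead_of_removeHook {s : ℕ} {la mu : YoungDiagram} (h : RemoveHook s la mu) :
    ∃ b, b ∈ beta 0 la ∧ b - s ∉ beta 0 la ∧
      ∀ x, x ∈ beta 0 mu ↔ x = b - s ∨ (x ∈ beta 0 la ∧ x ≠ b) := by
  obtain ⟨i, k, hik⟩ := exists_strip_of_removeHook h
  have h1 := hik.card
  have h2 := card_of_removeHook h
  have h3 : bead mu k = bead la i - s := by rw [h2] at h1; push_cast at h1; linarith
  refine ⟨bead la i, mem_beta_zero.2 ⟨i, rfl⟩, h3 ▸ hik.bead_notMem, fun x => ?_⟩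
  rw [hik.mem_beta, h3]

theorem IsStrip.rowLen_le {la mu : YoungDiagram} {i k : ℕ} (h : IsStrip la mu i k) (j : ℕ) :
    mu.rowLen j ≤ la.rowLen j := by
  rcases lt_or_ge j i with h1 | h1
  · exact (h.above j h1).le
  · rcases lt_trichotomy j k with h2 | rfl | h2
    · have := h.shift j h1 h2
      have := la.rowLen_anti j (j + 1) (Nat.le_succ j)
      omega
    · exact h.lt.le
    · exact (h.below j h2).le

/-- For connectedness, every cell walks to the lowest left cell `(k, mu.rowLen k)`: left along its
row, then into the next row in the same column, which meets the strip there because `la.rowLen (a +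
1) = mu.rowLen a + 1`. Each step lowers `(k - a) + c`. -/
theorem IsStrip.isRimHook {la mu : YoungDiagram} {i k : ℕ} (h : IsStrip la mu i k) {s : ℕ}
    (hs : la.card = mu.card + s) : IsRimHook s la (la.cells \ mu.cells) := by
  have hmem : ∀ a c, (a, c) ∈ la.cells \ mu.cells ↔ mu.rowLen a ≤ c ∧ c < la.rowLen a := by
    intro a c
    rw [Finset.mem_sdiff, YoungDiagram.mem_cells, YoungDiagram.mem_cells,
      YoungDiagram.mem_iff_lt_rowLen, YoungDiagram.mem_iff_lt_rowLen]
    omega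
  have hrows : ∀ a, mu.rowLen a < la.rowLen a → i ≤ a ∧ a ≤ k := fun a ha => by
    have := h.above a
    have := h.below a
    omega
  have hsub : mu.cells ⊆ la.cells := by
    rintro ⟨a, c⟩ hc
    rw [YoungDiagram.mem_cells, YoungDiagram.mem_iff_lt_rowLen] at hc ⊢
    have := h.rowLen_le a
    omega
  refine ⟨?_, ?_, ?_, ?_⟩
  · rintro ⟨a, c⟩ hc
    refine Finset.mem_filter.2 ⟨(Finset.mem_sdiff.1 hc).1, ?_⟩
    rw [hmem] at hc
    rw [YoungDiagram.mem_iff_lt_rowLen]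
    obtain ⟨h1, h2⟩ := hrows a (by omega)
    simp only
    rcases h2.lt_or_eq with h3 | rfl
    · have := h.shift a h1 h3
      omega
    · have := h.below (a + 1) (by omega)
      have := mu.rowLen_anti a (a + 1) (by omega)
      omega
  · have := Finset.card_sdiff_add_card_eq_card hsub
    have h1 : la.card = la.cells.card := rfl
    have h2 : mu.card = mu.cells.card := rfl
    omega
  · have hk := (hmem k (mu.rowLen k)).2 ⟨le_rfl, h.lt⟩
    have hreach : ∀ n a c, (hac : (a, c) ∈ la.cells \ mu.cells) → (k - a) + c = n →
        ((SimpleGraph.hasse (ℕ × ℕ)).induce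
          ((la.cells \ mu.cells : Finset (ℕ × ℕ)) : Set (ℕ × ℕ))).Reachable
          ⟨(a, c), hac⟩ ⟨(k, mu.rowLen k), hk⟩ := by
      intro n
      induction n with
      | zero =>
        intro a c hac hn
        have h1 := (hmem a c).1 hac
        have h2 := (hrows a (by omega)).2
        obtain ⟨rfl, rfl⟩ : a = k ∧ c = mu.rowLen a := by omega
        exact SimpleGraph.Reachable.refl _
      | succ n ih =>
        intro a c hac hn
        have h1 := (hmem a c).1 hac
        obtain ⟨h2, h3⟩ := hrows a (by omega)
        rcases h1.1.lt_or_eq with h4 | h4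
        · have hac' : (a, c - 1) ∈ la.cells \ mu.cells := (hmem _ _).2 (by omega)
          refine SimpleGraph.Reachable.trans (SimpleGraph.Adj.reachable ?_)
            (ih a (c - 1) hac' (by omega))
          simp only [SimpleGraph.comap_adj, Function.Embedding.subtype_apply,
            SimpleGraph.hasse_adj, Prod.mk_covBy_mk_iff, Nat.covBy_iff_add_one_eq,
            and_true]
          omega
        · rcases h3.lt_or_eq with h5 | rfl
          · have h6 := h.shift a h2 h5
            have h7 : mu.rowLen (a + 1) ≤ mu.rowLen a := mu.rowLen_anti a (a + 1) (by omega)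
            have hac' : (a + 1, c) ∈ la.cells \ mu.cells := (hmem _ _).2 (by omega)
            refine SimpleGraph.Reachable.trans (SimpleGraph.Adj.reachable ?_)
              (ih (a + 1) c hac' (by omega))
            simp
          · subst h4
            exact SimpleGraph.Reachable.refl _
    have : Nonempty ((la.cells \ mu.cells : Finset (ℕ × ℕ)) : Set (ℕ × ℕ)) := ⟨⟨_, hk⟩⟩
    refine SimpleGraph.Connected.mk fun u v => ?_
    exact (hreach _ u.1.1 u.1.2 u.2 rfl).trans (hreach _ v.1.1 v.1.2 v.2 rfl).symm
  · rw [Finset.sdiff_sdiff_eq_self hsub]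
    exact mu.isLowerSet

/-- The beta-set of an `s`-core is closed under subtraction of `s`. -/
theorem IsCore.sub_mem {s : ℕ} (hs : 0 < s) {la : YoungDiagram} (h : IsCore s la) :
    ∀ b ∈ beta 0 la, b - s ∈ beta 0 la := by
  intro b hb
  by_contra hbs
  obtain ⟨i, rfl⟩ := mem_beta_zero.1 hb
  have hlow : ∀ n : ℕ, la.rowLen n = 0 → -((n : ℤ) + 1) ≤ bead la i - s := by
    intro n hn
    by_contra hlt
    refine hbs (mem_beta_zero.2 ⟨(-(bead la i - s) - 1).toNat, ?_⟩)
    have h2 := la.rowLen_anti n (-(bead la i - s) - 1).toNat (by omega)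
    have h3 : la.rowLen (-(bead la i - s) - 1).toNat = 0 := by omega
    simp only [bead] at *
    rw [h3]
    push_cast
    omega
  have hbd : ∀ j, bead la i - s < bead la j → j < la.colLen 0 := by
    intro j hj
    by_contra hlt
    have h1 := rowLen_eq_zero (la := la) (not_lt.1 hlt)
    have := hlow j h1
    simp only [bead, h1] at *
    omega
  classical
  -- The bead `i` moves to a vacant place, jumping over the beads `i + 1, …, k`; here `k` is the
  -- last bead above that place.
  let P : ℕ → Prop := fun j => bead la i - s < bead la j
  obtain ⟨k, hk, hmax⟩ : ∃ k, P k ∧ ∀ j, k < j → ¬ P j :=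
    ⟨Nat.findGreatest P (la.colLen 0), Nat.findGreatest_spec (m := i) (hbd i (by omega)).le
      (show bead la i - s < bead la i by omega), fun j hj hPj =>
        absurd (Nat.le_findGreatest (hbd j hPj).le hPj) (by omega)⟩
  have hik : i ≤ k := by
    by_contra hlt
    exact hmax i (by omega) (show bead la i - s < bead la i by omega)
  have hk' : bead la i - s < bead la k := hk
  have hlt : bead la (k + 1) < bead la i - s := by
    have h1 : ¬ bead la i - s < bead la (k + 1) := hmax (k + 1) (by omega)
    have h2 : bead la i - s ≠ bead la (k + 1) := fun h => hbs (mem_beta_zero.2 ⟨_, h⟩)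
    omega
  have hpos : ∀ j, j ≤ k → 0 < la.rowLen j := by
    intro j hj
    have h1 := la.rowLen_anti j k hj
    by_contra h0
    have h2 : la.rowLen k = 0 := by omega
    have := hlow k h2
    simp only [bead, h2] at *
    omega
  -- The new length of row `k`, chosen so that its bead sits at `bead la i - s`.
  obtain ⟨m, hm⟩ : ∃ m : ℕ, (m : ℤ) = bead la i - s + k + 1 := by
    refine ⟨(bead la i - s + k + 1).toNat, ?_⟩
    simp only [bead] at *
    push_cast at hlt
    omega
  obtain ⟨mu, hmu⟩ := exists_rowLen
    (fun j => if j < i then la.rowLen j else if j < k then la.rowLen (j + 1) - 1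
      else if j = k then m else la.rowLen j)
    (antitone_nat_of_succ_le fun j => by
      have h1 := la.rowLen_anti j (j + 1) (by omega)
      have h2 := la.rowLen_anti (j + 1) (j + 2) (by omega)
      have h3 := hpos j
      have h4 := hpos (j + 1)
      rcases eq_or_ne j k with rfl | hjk
      · simp only [bead] at *
        push_cast at *
        split_ifs <;> omega
      · rcases eq_or_ne (j + 1) k with rfl | hjk
        · simp only [bead] at *
          push_cast at *
          split_ifs <;> omega
        · simp only [add_assoc, Nat.reduceAdd] at *
          split_ifs <;> omega)
    (la.colLen 0 + k + 1) (by
      have h1 := rowLen_eq_zero (la := la) (i := la.colLen 0 + k + 1) (by omega)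
      simp only [h1]
      split_ifs <;> omega)
  have hstrip : IsStrip la mu i k := by
    refine ⟨hik, fun j hj => ?_, fun j hj => ?_, fun j h1 h2 => ?_, ?_⟩
    · rw [hmu, if_pos hj]
    · rw [hmu, if_neg (by omega), if_neg (by omega), if_neg (by omega)]
    · have := hpos (j + 1) h2
      rw [hmu, if_neg (by omega), if_pos h2]
      omega
    · rw [hmu, if_neg (by omega), if_neg (by omega), if_pos rfl]
      simp only [bead] at *
      omega
  have hcard := hstrip.card
  have hmk : mu.rowLen k = m := by rw [hmu, if_neg (by omega), if_neg (by omega), if_pos rfl]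
  refine h _ (hstrip.isRimHook (s := s) ?_)
  simp only [bead, hmk] at *
  omega

/-! ### Beta-sets are exactly the Maya diagrams of charge zero. -/

theorem isMaya_beta (la : YoungDiagram) : IsMaya (beta 0 la) := by
  refine isMaya_iff.2 ⟨la.rowLen 0 + la.colLen 0 + 1, fun x => ⟨fun h hx => ?_, fun h => ?_⟩⟩
  · obtain ⟨i, rfl⟩ := mem_beta_zero.1 hx
    have := la.rowLen_anti 0 i (Nat.zero_le i)
    simp only [bead] at h
    omega
  · refine mem_beta_zero.2 ⟨(-x - 1).toNat, ?_⟩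
    rw [bead, rowLen_eq_zero (by omega)]
    push_cast
    omega

theorem mem_beta {la : YoungDiagram} {r x : ℤ} : x ∈ beta r la ↔ x - r ∈ beta 0 la := by
  simp only [beta, Set.mem_ofPred_eq, add_zero]
  exact exists_congr fun i => by rw [eq_comm, sub_eq_iff_eq_add, eq_comm]

theorem beta_zero_injective : Function.Injective (beta 0) := by
  intro la mu h
  have hm : ∀ la : YoungDiagram, StrictMono fun i => -bead la i := fun la i j hij =>
    neg_lt_neg (bead_lt la hij)
  have hr : ∀ la : YoungDiagram, Set.range (fun i => -bead la i) = {x | -x ∈ beta 0 la} := by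
    intro la
    ext x
    rw [Set.mem_ofPred_eq, mem_beta_zero]
    exact exists_congr fun i => by
      rw [eq_comm, eq_neg_iff_add_eq_zero, neg_eq_iff_add_eq_zero, add_comm]
  have h1 := ((hm la).range_inj (hm mu)).1 (by rw [hr, hr, h])
  refine ext_rowLen fun i => ?_
  have h2 := congrFun h1 i
  simp only [bead] at h2
  omega

theorem exists_msum_of_removeHook {s : ℕ} {la mu : YoungDiagram} (h : RemoveHook s la mu) :
    ∃ b : ℤ, ∀ f, msum f (beta 0 mu) = msum f (beta 0 la) + f (b - s) - f b := by
  obtain ⟨b, hb, hbs, hmem⟩ := exists_bead_of_removeHook h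
  refine ⟨b, msum_move_single (isMaya_beta mu) (isMaya_beta la) b (b - s) fun x => ?_⟩
  have h1 : x ∈ ({b} : Set ℤ) ↔ x = b := Iff.rfl
  have h2 : x ∈ ({b - s} : Set ℤ) ↔ x = b - s := Iff.rfl
  have hne : b ≠ b - s := fun h => hbs (h ▸ hb)
  by_cases hx : x = b
  · subst hx
    rw [ind_of_notMem (fun h => by have := (hmem x).1 h; tauto), ind_of_mem hb,
      ind_of_notMem (fun h => hne (h2.1 h)), ind_of_mem (h1.2 rfl)]
    rfl
  · rw [ind_of_notMem (B := {b}) (fun h => hx (h1.1 h))]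
    by_cases hx' : x = b - s
    · rw [ind_of_mem ((hmem x).2 (Or.inl hx')), ind_of_mem (h2.2 hx'),
        ind_of_notMem (hx' ▸ hbs)]
      rfl
    · rw [ind_of_notMem (B := {b - (s : ℤ)}) (fun h => hx' (h2.1 h)),
        ind_congr (A := beta 0 mu) (B := beta 0 la) (y := x) (by rw [hmem]; tauto)]
      ring

/-- A move by `s` is invisible to `s`-periodic weights. These invariants will turn out to determine
the core. -/
theorem msum_of_reflTransGen {s : ℕ} {la mu : YoungDiagram}
    (h : Relation.ReflTransGen (RemoveHook s) la mu) {f : ℤ → ℤ} (hf : ∀ x, f (x - s) = f x) :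
    msum f (beta 0 mu) = msum f (beta 0 la) := by
  induction h with
  | refl => rfl
  | tail _ h ih =>
    obtain ⟨b, hb⟩ := exists_msum_of_removeHook h
    rw [hb, hf, ih]
    ring

theorem core_spec (s : ℕ) (la : YoungDiagram) :
    Relation.ReflTransGen (RemoveHook s) la (core s la) ∧ IsCore s (core s la) :=
  Classical.choose_spec (exists_core s la)

theorem msum_core {s : ℕ} (la : YoungDiagram) {f : ℤ → ℤ} (hf : ∀ x, f (x - s) = f x) :
    msum f (beta 0 (core s la)) = msum f (beta 0 la) :=
  msum_of_reflTransGen (core_spec s la).1 hf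

/-- Removing 1-hooks preserves the charge `c` and ends at the set of all integers below `c`.
Comparing its decreasing enumeration with the beads at an index where the row is empty forces `c =
0`. -/
theorem msum_one_beta_zero (la : YoungDiagram) : msum 1 (beta 0 la) = 0 := by
  rw [← msum_core (s := 1) la fun _ => rfl]
  have h := eq_Iio_of_closed (isMaya_beta _)
    (by simpa using ((core_spec 1 la).2).sub_mem one_pos)
  set ka := core 1 la
  set c := msum 1 (beta 0 ka)
  have h1 := (show StrictMono fun i => -bead ka i from fun i j hij =>
    neg_lt_neg (bead_lt ka hij)).range_inj
      (g := fun i : ℕ => (i : ℤ) + 1 - c) (fun i j hij => by simp only; omega)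
  have h2 : (fun i => -bead ka i) = fun i : ℕ => (i : ℤ) + 1 - c := by
    refine h1.1 (Set.ext fun x => ?_)
    have h3 : -x ∈ beta 0 ka ↔ -x < c := by rw [h, Set.mem_Iio]
    rw [mem_beta_zero] at h3
    simp only [Set.mem_range]
    constructor
    · rintro ⟨i, hi⟩
      have := h3.1 ⟨i, by omega⟩
      exact ⟨(x + c - 1).toNat, by omega⟩
    · rintro ⟨i, hi⟩
      obtain ⟨j, hj⟩ := h3.2 (by omega)
      exact ⟨j, by omega⟩
  have h3 := congrFun h2 (ka.colLen 0)
  simp only [bead, rowLen_eq_zero (la := ka) le_rfl] at h3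
  omega

theorem msum_one_beta (r : ℤ) (la : YoungDiagram) : msum 1 (beta r la) = r := by
  have h : beta r la = {x | x + -r ∈ beta 0 la} := Set.ext fun x => by
    rw [mem_beta, sub_eq_add_neg]; rfl
  rw [h, msum_one_shift (isMaya_beta la), msum_one_beta_zero]
  ring

theorem exists_beta_zero {B : Set ℤ} (hB : IsMaya B) (h : msum 1 B = 0) :
    ∃ la : YoungDiagram, beta 0 la = B := by
  obtain ⟨la, r, hr⟩ := exists_beta B hB.1 hB.2
  rw [← hr, msum_one_beta] at h
  exact ⟨la, by rw [← hr, h]⟩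

/-! ### Runners of the abacus -/

/-- The elements of `B` in the residue class of `a` modulo `s`, rescaled. -/
def runner (s : ℕ) (B : Set ℤ) (a : ℤ) : Set ℤ := {x | a + s * x ∈ B}

/-- The representative of the class of `a` modulo `s` that marks the charge of the runner. -/
def elt (s : ℕ) (B : Set ℤ) (a : ℤ) : ℤ := a + s * msum 1 (runner s B a)

/-- The runner of `a`, shifted to charge zero. -/
def frame (s : ℕ) (B : Set ℤ) (a : ℤ) : Set ℤ := {x | elt s B a + s * x ∈ B}

section Runner

variable {s : ℕ}

theorem runner_add_mul (B : Set ℤ) (a k : ℤ) :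
    runner s B (a + s * k) = {x | x + k ∈ runner s B a} :=
  Set.ext fun x => by
    simp only [runner, Set.mem_ofPred_eq]
    rw [show a + s * k + s * x = a + s * (x + k) by ring]

theorem exists_eq_add_mul {a b : ℤ} (h : (a : ZMod s) = b) : ∃ k, b = a + s * k := by
  obtain ⟨k, hk⟩ := (ZMod.intCast_eq_intCast_iff_dvd_sub a b s).1 h
  exact ⟨k, by linarith⟩

theorem intCast_elt (B : Set ℤ) (a : ℤ) : (elt s B a : ZMod s) = a := by
  simp [elt]

theorem frame_eq_shift (B : Set ℤ) (a : ℤ) :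
    frame s B a = {x | x + msum 1 (runner s B a) ∈ runner s B a} := by
  ext x
  simp only [frame, elt, runner, Set.mem_ofPred_eq]
  ring_nf

theorem mem_iff_mem_frame (B : Set ℤ) (x : ℤ) :
    x ∈ B ↔ -msum 1 (runner s B x) ∈ frame s B x := by
  simp [frame, elt]

variable [NeZero s] {B : Set ℤ}

theorem isMaya_runner (hB : IsMaya B) (a : ℤ) : IsMaya (runner s B a) := by
  have hs : (1 : ℤ) ≤ s := by exact_mod_cast Nat.one_le_iff_ne_zero.2 (NeZero.ne s)
  obtain ⟨N, hN⟩ := isMaya_iff.1 hB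
  have h1 := abs_nonneg N
  have h2 := abs_nonneg a
  have h3 := abs_le.1 (le_refl |N|)
  have h4 := abs_le.1 (le_refl |a|)
  exact isMaya_iff.2 ⟨|N| + |a|, fun x => ⟨fun hx => (hN _).1 (by nlinarith),
    fun hx => (hN _).2 (by nlinarith)⟩⟩

theorem elt_add_mul (hB : IsMaya B) (a k : ℤ) : elt s B (a + s * k) = elt s B a := by
  rw [elt, elt, runner_add_mul, msum_one_shift (isMaya_runner hB a)]
  ring

theorem elt_congr (hB : IsMaya B) {a b : ℤ} (h : (a : ZMod s) = b) : elt s B a = elt s B b := by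
  obtain ⟨k, rfl⟩ := exists_eq_add_mul h
  rw [elt_add_mul hB]

theorem frame_congr (hB : IsMaya B) {a b : ℤ} (h : (a : ZMod s) = b) :
    frame s B a = frame s B b := by
  rw [frame, elt_congr hB h, frame]

theorem intCast_val (i : ZMod s) : ((i.val : ℤ) : ZMod s) = i := by simp

theorem isMaya_frame (hB : IsMaya B) (a : ℤ) : IsMaya (frame s B a) :=
  isMaya_runner hB _

theorem msum_one_frame (hB : IsMaya B) (a : ℤ) : msum 1 (frame s B a) = 0 := by
  rw [frame_eq_shift, msum_one_shift (isMaya_runner hB a), sub_self]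

theorem dwt_runner (hB : IsMaya B) (a : ℤ) : dwt (runner s B a) = dwt (frame s B a) := by
  rw [frame_eq_shift, dwt_shift (isMaya_runner hB a)]

theorem eq_of_elt_of_frame {A : Set ℤ} (hA : IsMaya A) (hB : IsMaya B)
    (h1 : ∀ i : ZMod s, elt s A i.val = elt s B i.val)
    (h2 : ∀ i : ZMod s, frame s A i.val = frame s B i.val) : A = B := by
  ext x
  have hx : (x : ZMod s) = (((x : ZMod s).val : ℤ) : ZMod s) := by simp
  have h3 : elt s A x = elt s B x := by rw [elt_congr hA hx, h1, elt_congr hB hx]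
  have h4 : frame s A x = frame s B x := by rw [frame_congr hA hx, h2, frame_congr hB hx]
  rw [mem_iff_mem_frame (s := s) A, mem_iff_mem_frame (s := s) B, h4]
  have hs : (s : ℤ) ≠ 0 := by exact_mod_cast NeZero.ne s
  rw [mul_left_cancel₀ hs (add_left_cancel h3)]

/-- Sums over a runner become sums over `B`. The representative `i.val` in `[0, s)` matters: it
makes `i.val + s * x < 0` equivalent to `x < 0`, so the two normalisations agree. -/
theorem msum_runner (B : Set ℤ) (g : ℤ → ℤ) (i : ZMod s) :
    msum g (runner s B i.val) =
      msum (fun y => if y % s = i.val then g (y / s) else 0) B := by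
  have hs : (0 : ℤ) < s := by exact_mod_cast Nat.pos_of_ne_zero (NeZero.ne s)
  have hi : (i.val : ℤ) < s := by exact_mod_cast ZMod.val_lt i
  have hinj : Function.Injective fun x : ℤ => (i.val : ℤ) + s * x := fun x y h => 
    mul_left_cancel₀ hs.ne' (add_left_cancel h)
  rw [msum, msum]
  have h1 := finsum_mem_range (f := fun y => (ind B y - ind (Set.Iio 0) y) * g (y / s)) hinj
  rw [finsum_mem_def] at h1
  have hdiv : ∀ x : ℤ, ((i.val : ℤ) + s * x) / s = x := fun x => by
    rw [Int.add_mul_ediv_left _ _ hs.ne', Int.ediv_eq_zero_of_lt (by omega) hi, zero_add]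
  calc _ = _ := finsum_congr fun x => ?_
    _ = _ := h1.symm
    _ = _ := finsum_congr fun y => ?_
  · rw [hdiv, ind_congr (A := runner s B i.val) (B := B) (y := i.val + s * x) Iff.rfl,
      ind_congr (A := Set.Iio 0) (B := Set.Iio 0) (x := x) (y := i.val + s * x)]
    simp only [Set.mem_Iio]
    constructor
    · intro hx; nlinarith
    · intro hx; by_contra h; nlinarith
  · by_cases hy : y % s = i.val
    · rw [if_pos hy, Set.indicator_of_mem]
      exact ⟨y / s, by simp only; rw [← hy, Int.emod_add_mul_ediv]⟩
    · rw [if_neg hy, Set.indicator_of_notMem, mul_zero]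
      rintro ⟨x, rfl⟩
      apply hy
      simp only [Int.add_mul_emod_self_left]
      exact Int.emod_eq_of_lt (by omega) hi

/-- For a Maya diagram closed under subtraction of `s`, membership is decided by `elt`. -/
theorem mem_iff_lt_elt (hB : IsMaya B) (h : ∀ b ∈ B, b - s ∈ B) (x : ℤ) :
    x ∈ B ↔ x < elt s B x := by
  have hs : (0 : ℤ) < s := by exact_mod_cast Nat.pos_of_ne_zero (NeZero.ne s)
  have h1 := eq_Iio_of_closed (isMaya_runner (s := s) hB x) fun y hy => by
    have := h _ hy
    rwa [add_sub_assoc, ← mul_sub_one] at this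
  have h2 : x ∈ B ↔ (0 : ℤ) ∈ runner s B x := by simp [runner]
  rw [h2, h1, Set.mem_Iio, elt, lt_add_iff_pos_right, mul_pos_iff_of_pos_left hs]

theorem dwt_runner_of_closed (hB : IsMaya B) (h : ∀ b ∈ B, b - s ∈ B) (a : ℤ) :
    dwt (runner s B a) = 0 := by
  rw [eq_Iio_of_closed (isMaya_runner (s := s) hB a) fun y hy => by
    have := h _ hy
    rwa [add_sub_assoc, ← mul_sub_one] at this, dwt_Iio]

end Runner

/-! ### Cores, quotients and weights read off the runners. -/

section Core

variable {s : ℕ} [NeZero s]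

theorem IsCore.closed {la : YoungDiagram} (h : IsCore s la) :
    ∀ b ∈ beta 0 la, b - s ∈ beta 0 la :=
  h.sub_mem (Nat.pos_of_ne_zero (NeZero.ne s))

/-- The charge of a runner is the regularised sum of the indicator of its class, which is
`s`-periodic. -/
theorem elt_eq_of_msum_eq {A B : Set ℤ} (hA : IsMaya A) (hB : IsMaya B)
    (h : ∀ f : ℤ → ℤ, (∀ x, f (x - s) = f x) → msum f A = msum f B) (a : ℤ) :
    elt s A a = elt s B a := by
  have ha : (a : ZMod s) = (((a : ZMod s).val : ℤ) : ZMod s) := by simp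
  rw [elt_congr hA ha, elt_congr hB ha, elt, elt, msum_runner, msum_runner, h]
  intro x
  rw [Int.sub_emod_right]
  rfl

theorem elt_core (la : YoungDiagram) (a : ℤ) :
    elt s (beta 0 (core s la)) a = elt s (beta 0 la) a :=
  elt_eq_of_msum_eq (isMaya_beta _) (isMaya_beta _) (fun _ hf => msum_core la hf) a

theorem IsCore.eq_of_elt_eq {la mu : YoungDiagram} (hla : IsCore s la) (hmu : IsCore s mu)
    (h : ∀ a, elt s (beta 0 la) a = elt s (beta 0 mu) a) : la = mu := by
  refine beta_zero_injective (Set.ext fun x => ?_)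
  rw [mem_iff_lt_elt (isMaya_beta la) hla.closed, mem_iff_lt_elt (isMaya_beta mu) hmu.closed, h]

theorem core_eq_of_elt_eq {la mu : YoungDiagram}
    (h : ∀ a, elt s (beta 0 la) a = elt s (beta 0 mu) a) : core s la = core s mu :=
  (core_spec s la).2.eq_of_elt_eq (core_spec s mu).2 fun a => by rw [elt_core, elt_core, h]

theorem core_eq_of_msum_eq {la mu : YoungDiagram}
    (h : ∀ f : ℤ → ℤ, (∀ x, f (x - s) = f x) → msum f (beta 0 la) = msum f (beta 0 mu)) :
    core s la = core s mu :=
  core_eq_of_elt_eq (elt_eq_of_msum_eq (isMaya_beta la) (isMaya_beta mu) h)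

theorem elt_eq_of_core_eq {la mu : YoungDiagram} (h : core s la = core s mu) (a : ℤ) :
    elt s (beta 0 la) a = elt s (beta 0 mu) a := by
  rw [← elt_core, h, elt_core]

theorem IsCore.core_eq {la : YoungDiagram} (h : IsCore s la) : core s la = la :=
  (core_spec s la).2.eq_of_elt_eq h fun a => elt_core la a

/-- A partition whose beta-set is closed under subtraction of `s` is its own `s`-core. -/
theorem core_eq_of_closed {la : YoungDiagram} (h : ∀ b ∈ beta 0 la, b - s ∈ beta 0 la) :
    core s la = la := by
  refine beta_zero_injective (Set.ext fun x => ?_)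
  rw [mem_iff_lt_elt (isMaya_beta _) (core_spec s la).2.closed, mem_iff_lt_elt (isMaya_beta la) h,
    elt_core]

theorem sSetElt_eq (la : YoungDiagram) (i : ZMod s) :
    sSetElt s la i = elt s (beta 0 la) i.val := by
  refine IsLeast.csInf_eq ⟨⟨?_, ?_⟩, ?_⟩
  · rw [intCast_elt, intCast_val]
  · rw [mem_iff_lt_elt (isMaya_beta _) (core_spec s la).2.closed, elt_core,
      elt_congr (isMaya_beta la) (intCast_elt _ _)]
    exact lt_irrefl _
  · rintro n ⟨rfl, hn⟩
    rw [mem_iff_lt_elt (isMaya_beta _) (core_spec s la).2.closed, elt_core, not_lt] at hn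
    rwa [elt_congr (isMaya_beta la) (b := n) (intCast_val _)]

theorem beta_quo (la : YoungDiagram) (i : ZMod s) :
    beta 0 (quo s la i) = frame s (beta 0 la) i.val := by
  obtain ⟨r, hr⟩ := Classical.choose_spec (exists_quo s la (i.val : ℤ))
  change beta r (quo s la i) = runner s (beta 0 la) i.val at hr
  rw [frame_eq_shift, ← hr, msum_one_beta]
  ext x
  rw [Set.mem_ofPred_eq, mem_beta (r := r), add_sub_cancel_right]

theorem quo_eq_quo_iff {la mu : YoungDiagram} {i j : ZMod s} :
    quo s la i = quo s mu j ↔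
      frame s (beta 0 la) i.val = frame s (beta 0 mu) j.val := by
  rw [← beta_quo, ← beta_quo, beta_zero_injective.eq_iff]

/-- Twice the `s`-weight, in terms of the beta-set. -/
def dweight (s : ℕ) [NeZero s] (B : Set ℤ) : ℤ := ∑ i : ZMod s, dwt (runner s B i.val)

/-- On one runner a single bead descends by one place: the charge stays and `msum id` drops by `1`.
-/
theorem dweight_of_removeHook {la mu : YoungDiagram} (h : RemoveHook s la mu) :
    dweight s (beta 0 la) = dweight s (beta 0 mu) + 2 := by
  have hs : (0 : ℤ) < s := by exact_mod_cast Nat.pos_of_ne_zero (NeZero.ne s)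
  obtain ⟨b, hb⟩ := exists_msum_of_removeHook h
  have h1 : ∀ i : ZMod s, dwt (runner s (beta 0 la) i.val) =
      dwt (runner s (beta 0 mu) i.val) + if i = (b : ZMod s) then 2 else 0 := by
    intro i
    have hi : b % s = i.val ↔ i = (b : ZMod s) := by
      rw [← ZMod.val_intCast, Nat.cast_inj, eq_comm]
      exact (ZMod.val_injective s).eq_iff
    have hdiv : (b - s) / (s : ℤ) = b / s - 1 := by
      rw [Int.sub_ediv_of_dvd _ (dvd_refl _), Int.ediv_self hs.ne']
    have hc : msum 1 (runner s (beta 0 mu) i.val) = msum 1 (runner s (beta 0 la) i.val) := by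
      rw [msum_runner, msum_runner, hb, Int.sub_emod_right]
      simp
    have he : msum id (runner s (beta 0 mu) i.val) = msum id (runner s (beta 0 la) i.val) -
        if i = (b : ZMod s) then 1 else 0 := by
      rw [msum_runner, msum_runner, hb, Int.sub_emod_right, hdiv]
      simp only [hi, id]
      split_ifs <;> ring
    rw [dwt, dwt, hc, he]
    split_ifs <;> ring
  rw [dweight, Finset.sum_congr rfl fun i _ => h1 i, Finset.sum_add_distrib]
  simp [dweight]

theorem dweight_of_closed {B : Set ℤ} (hB : IsMaya B) (h : ∀ b ∈ B, b - s ∈ B) :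
    dweight s B = 0 :=
  Finset.sum_eq_zero fun i _ => dwt_runner_of_closed hB h i.val

theorem exists_number_of_hooks {la mu : YoungDiagram}
    (h : Relation.ReflTransGen (RemoveHook s) la mu) :
    ∃ n : ℕ, la.card = mu.card + s * n ∧ dweight s (beta 0 la) = dweight s (beta 0 mu) + 2 * n := by
  induction h with
  | refl => exact ⟨0, by simp⟩
  | tail _ h ih =>
    obtain ⟨n, h1, h2⟩ := ih
    refine ⟨n + 1, ?_, ?_⟩
    · rw [h1, card_of_removeHook h]; ring
    · rw [h2, dweight_of_removeHook h]; push_cast; ring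

theorem card_eq_and_dweight_eq (la : YoungDiagram) :
    la.card = (core s la).card + s * weight s la ∧ dweight s (beta 0 la) = 2 * weight s la := by
  obtain ⟨n, h1, h2⟩ := exists_number_of_hooks (core_spec s la).1
  rw [dweight_of_closed (isMaya_beta _) (core_spec s la).2.closed, zero_add] at h2
  have h3 : weight s la = n := by
    rw [weight, h1, Nat.add_sub_cancel_left,
      Nat.mul_div_cancel_left _ (Nat.pos_of_ne_zero (NeZero.ne s))]
  rw [h3]
  exact ⟨h1, h2⟩

theorem dweight_eq_iff {la mu : YoungDiagram} :
    dweight s (beta 0 la) = dweight s (beta 0 mu) ↔ weight s la = weight s mu := by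
  rw [(card_eq_and_dweight_eq la).2, (card_eq_and_dweight_eq mu).2]
  omega

end Core

/-! ### Equality of weighted quotients as a matching of runners. -/

theorem exists_perm_of_map_univ_eq {α β : Type*} [Fintype α] {f g : α → β}
    (h : (Finset.univ : Finset α).val.map f = (Finset.univ : Finset α).val.map g) :
    ∃ e : Equiv.Perm α, ∀ a, f a = g (e a) := by
  classical
  have hc : ∀ b, Nonempty ({a // f a = b} ≃ {a // g a = b}) := fun b => by
    rw [← Fintype.card_eq, Fintype.card_subtype, Fintype.card_subtype]
    have h1 := congrArg (Multiset.count b) h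
    rw [Multiset.count_map, Multiset.count_map] at h1
    simp only [Finset.card, Finset.filter_val, eq_comm (b := b)]
    exact h1
  exact ⟨Equiv.ofFiberEquiv fun b => (hc b).some, fun a =>
    (Equiv.ofFiberEquiv_map (fun b => (hc b).some) a).symm⟩

theorem weightedQuotient_eq_iff {s : ℕ} [NeZero s] (t : ℕ) {la mu : YoungDiagram} :
    weightedQuotient s t la = weightedQuotient s t mu ↔
      ∃ e : Equiv.Perm (ZMod s), ∀ i : ZMod s,
        (elt s (beta 0 la) i.val : ZMod t) = elt s (beta 0 mu) (e i).val ∧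
          frame s (beta 0 la) i.val = frame s (beta 0 mu) (e i).val := by
  simp only [← sSetElt_eq, ← quo_eq_quo_iff]
  constructor
  · intro h
    obtain ⟨e, he⟩ := exists_perm_of_map_univ_eq h
    exact ⟨e, fun i => Prod.mk.inj (he i)⟩
  · rintro ⟨e, he⟩
    rw [weightedQuotient, weightedQuotient]
    conv_rhs => rw [← Multiset.map_univ_val_equiv e, Multiset.map_map]
    exact Multiset.map_congr rfl fun i _ => Prod.ext (he i).1 (he i).2

/-! ### Displacing whole runners. -/

section Transport

variable {s : ℕ} {A B : Set ℤ}

/-- Moving whole runners by the displacements `d`. -/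
theorem runner_of_displacement {d : ZMod s → ℤ} (hAB : ∀ x : ℤ, x ∈ A ↔ x + d x ∈ B) (a : ℤ) :
    runner s A a = runner s B (a + d a) := by
  ext x
  simp only [runner, Set.mem_ofPred_eq]
  rw [hAB]
  push_cast
  rw [ZMod.natCast_self, zero_mul, add_zero, add_right_comm]

theorem elt_of_displacement {d : ZMod s → ℤ} (hAB : ∀ x : ℤ, x ∈ A ↔ x + d x ∈ B) (a : ℤ) :
    elt s A a = elt s B (a + d a) - d a := by
  rw [elt, elt, runner_of_displacement hAB]
  ring

theorem frame_of_displacement {d : ZMod s → ℤ} (hAB : ∀ x : ℤ, x ∈ A ↔ x + d x ∈ B) (a : ℤ) :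
    frame s A a = frame s B (a + d a) := by
  rw [frame_eq_shift, frame_eq_shift, runner_of_displacement hAB]

variable [NeZero s]

theorem elt_frame_of_displacement (hB : IsMaya B) {t : ℕ} {d : ZMod s → ℤ}
    (hAB : ∀ x : ℤ, x ∈ A ↔ x + d x ∈ B) (hd : ∀ i, (d i : ZMod t) = 0) {e : ZMod s → ZMod s}
    (he : ∀ i, i + d i = e i) (i : ZMod s) :
    (elt s A i.val : ZMod t) = elt s B (e i).val ∧ frame s A i.val = frame s B (e i).val := by
  have h : (((i.val : ℤ) + d (i.val : ℤ) : ℤ) : ZMod s) = (((e i).val : ℤ) : ZMod s) := by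
    push_cast
    rw [ZMod.natCast_zmod_val, ZMod.natCast_zmod_val, he]
  rw [elt_of_displacement hAB, frame_of_displacement hAB, elt_congr hB h, frame_congr hB h,
    Int.cast_sub, hd, sub_zero]
  exact ⟨rfl, rfl⟩

theorem dweight_eq_of_frame_eq (hA : IsMaya A) (hB : IsMaya B) (e : Equiv.Perm (ZMod s))
    (h : ∀ i : ZMod s, frame s A i.val = frame s B (e i).val) : dweight s A = dweight s B := by
  rw [dweight, dweight, ← Equiv.sum_comp e fun i => dwt (runner s B i.val)]
  exact Finset.sum_congr rfl fun i _ => by rw [dwt_runner hA, dwt_runner hB, h]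

end Transport

/-! ### Folding two runners together. -/

section Fold

variable {s t : ℕ} {B : Set ℤ} {a : ℤ}

/-- In the residue class of `a + t` modulo `s`, every bead `x` for which `x - t` is vacant is moved
down to `x - t`. -/
def fold (s t : ℕ) (B : Set ℤ) (a : ℤ) : Set ℤ :=
  {x | ((x : ZMod s) = a ∧ (x ∈ B ∨ x + t ∈ B)) ∨
    ((x : ZMod s) = a + t ∧ x ∈ B ∧ x - t ∈ B) ∨
    ((x : ZMod s) ≠ a ∧ (x : ZMod s) ≠ a + t ∧ x ∈ B)}

/-- The positions that receive a bead in the passage from `B` to `fold s t B a`. -/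
def foldTargets (s t : ℕ) (B : Set ℤ) (a : ℤ) : Set ℤ :=
  {x | (x : ZMod s) = a ∧ x ∉ B ∧ x + t ∈ B}

theorem mem_fold_left (hne : (a : ZMod s) ≠ a + t) {x : ℤ} (hx : (x : ZMod s) = a) :
    x ∈ fold s t B a ↔ x ∈ B ∨ x + t ∈ B := by
  simp [fold, hx, hne]

theorem mem_fold_right (hne : (a : ZMod s) ≠ a + t) {x : ℤ} (hx : (x : ZMod s) = a + t) :
    x ∈ fold s t B a ↔ x ∈ B ∧ x - t ∈ B := by
  simp only [fold, Set.mem_ofPred_eq, hx, hne.symm]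
  tauto

theorem mem_fold_other {x : ℤ} (h1 : (x : ZMod s) ≠ a) (h2 : (x : ZMod s) ≠ a + t) :
    x ∈ fold s t B a ↔ x ∈ B := by
  simp [fold, h1, h2]

theorem isMaya_fold (hB : IsMaya B) (hne : (a : ZMod s) ≠ a + t) : IsMaya (fold s t B a) := by
  refine hB.of_displacement t fun x => ?_
  by_cases h1 : (x : ZMod s) = a
  · rw [mem_fold_left hne h1]
    by_cases hx : x ∈ B
    · exact ⟨x, x, by simp, by simp, fun _ => Or.inl hx, fun _ => hx⟩
    · exact ⟨x, x + t, by simp, by simp, Or.inl, fun h => h.resolve_left hx⟩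
  · by_cases h2 : (x : ZMod s) = a + t
    · rw [mem_fold_right hne h2]
      by_cases hx : x ∈ B
      · exact ⟨x - t, x, by simp, by simp, fun h => ⟨hx, h⟩, fun h => h.1⟩
      · exact ⟨x, x, by simp, by simp, fun h => absurd h hx, fun h => h.1⟩
    · rw [mem_fold_other h1 h2]
      exact ⟨x, x, by simp, by simp, id, id⟩

theorem finite_foldTargets (hB : IsMaya B) : (foldTargets s t B a).Finite := by
  obtain ⟨N, hN⟩ := isMaya_iff.1 hB
  refine (Set.finite_Icc (-N - t) N).subset fun x hx => ?_
  obtain ⟨-, h1, h2⟩ := hx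
  refine ⟨?_, ?_⟩
  · by_contra h
    exact h1 ((hN x).2 (by omega))
  · by_contra h
    exact (hN (x + t)).1 (by omega) h2

theorem finite_support_ind {X : Set ℤ} (hX : X.Finite) : (Function.support (ind X)).Finite :=
  hX.subset fun x hx => by
    by_contra h
    exact hx (ind_of_notMem h)

theorem msum_fold (hB : IsMaya B) (hne : (a : ZMod s) ≠ a + t) (f : ℤ → ℤ) :
    msum f (fold s t B a) =
      msum f B + ∑ᶠ x, ind (foldTargets s t B a) x * (f x - f (x + t)) := by
  refine msum_move (isMaya_fold hB hne) hB t _ (finite_support_ind (finite_foldTargets hB))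
    (fun x => ?_) f
  have h3 : x ∈ foldTargets s t B a ↔ (x : ZMod s) = a ∧ x ∉ B ∧ x + t ∈ B := Iff.rfl
  have h4 : x - t ∈ foldTargets s t B a ↔ (x : ZMod s) = a + t ∧ x - t ∉ B ∧ x ∈ B := by
    simp [foldTargets, sub_eq_iff_eq_add]
  by_cases h1 : (x : ZMod s) = a
  · rw [ind_of_notMem (x := x - t) (fun h => hne (h1.symm.trans (h4.1 h).1))]
    have h5 := mem_fold_left (B := B) hne h1
    by_cases h6 : x ∈ B
    · rw [ind_of_mem (h5.2 (Or.inl h6)), ind_of_mem h6, ind_of_notMem (fun h => (h3.1 h).2.1 h6)]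
      rfl
    · rw [ind_of_notMem h6, ind_congr (A := fold s t B a) (B := foldTargets s t B a) (y := x)
        (by tauto)]
      ring
  · rw [ind_of_notMem (B := foldTargets s t B a) (x := x) (fun h => h1 (h3.1 h).1)]
    by_cases h2 : (x : ZMod s) = a + t
    · have h5 := mem_fold_right (B := B) hne h2
      by_cases h6 : x ∈ B
      · by_cases h7 : x - t ∈ B
        · rw [ind_of_mem (h5.2 ⟨h6, h7⟩), ind_of_mem h6, ind_of_notMem (fun h => (h4.1 h).2.1 h7)]
          rfl
        · rw [ind_of_notMem (fun h => h7 (h5.1 h).2), ind_of_mem h6,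
            ind_of_mem (h4.2 ⟨h2, h7, h6⟩)]
          rfl
      · rw [ind_of_notMem (fun h => h6 (h5.1 h).1), ind_of_notMem h6,
          ind_of_notMem (fun h => h6 (h4.1 h).2.2)]
        rfl
    · rw [ind_of_notMem (x := x - t) (fun h => h2 (h4.1 h).1),
        ind_congr (A := fold s t B a) (B := B) (y := x) (mem_fold_other h1 h2)]
      ring

theorem msum_fold_of_periodic (hB : IsMaya B) (hne : (a : ZMod s) ≠ a + t) {f : ℤ → ℤ}
    (hf : ∀ x, f (x - t) = f x) : msum f (fold s t B a) = msum f B := by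
  rw [msum_fold hB hne, finsum_eq_zero_of_forall_eq_zero, add_zero]
  intro x
  rw [← hf (x + t), add_sub_cancel_right, sub_self, mul_zero]

/-- Each moved bead lowers `msum id` by `t`; this makes repeated folding terminate. -/
theorem msum_id_fold_lt (hB : IsMaya B) (hne : (a : ZMod s) ≠ a + t) (ht : 0 < t)
    (h : (foldTargets s t B a).Nonempty) : msum id (fold s t B a) < msum id B := by
  have h1 : 0 < ∑ᶠ x, ind (foldTargets s t B a) x * (t : ℤ) := by
    obtain ⟨y, hy⟩ := h
    refine finsum_pos (fun x => ?_) ⟨y, ?_⟩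
      (finite_support_mul (finite_support_ind (finite_foldTargets hB)) _)
    · by_cases hx : x ∈ foldTargets s t B a
      · simp [ind_of_mem hx]
      · simp [ind_of_notMem hx]
    · simp [ind_of_mem hy, ht]
  have h2 : ∑ᶠ x, ind (foldTargets s t B a) x * (id x - id (x + t)) =
      -∑ᶠ x, ind (foldTargets s t B a) x * (t : ℤ) := by
    rw [← finsum_neg_distrib]
    exact finsum_congr fun x => by simp only [id]; ring
  rw [msum_fold hB hne, h2]
  linarith

theorem runner_fold_left (hne : (a : ZMod s) ≠ a + t) :
    runner s (fold s t B a) a = runner s B a ∪ runner s B (a + t) := by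
  ext x
  have h : ((a + s * x : ℤ) : ZMod s) = a := by simp
  simp only [runner, Set.mem_ofPred_eq, Set.mem_union]
  rw [mem_fold_left hne h, add_right_comm]

theorem runner_fold_right (hne : (a : ZMod s) ≠ a + t) :
    runner s (fold s t B a) (a + t) = runner s B a ∩ runner s B (a + t) := by
  ext x
  have h : ((a + t + s * x : ℤ) : ZMod s) = a + t := by simp
  simp only [runner, Set.mem_ofPred_eq, Set.mem_inter_iff]
  rw [mem_fold_right hne h, show a + t + s * x - t = a + s * x by ring, and_comm]

theorem runner_fold_other {b : ℤ} (h1 : (b : ZMod s) ≠ a) (h2 : (b : ZMod s) ≠ a + t) :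
    runner s (fold s t B a) b = runner s B b := by
  ext x
  have h : ((b + s * x : ℤ) : ZMod s) = b := by simp
  simp only [runner, Set.mem_ofPred_eq]
  rw [mem_fold_other (by rwa [h]) (by rwa [h])]

variable [NeZero s]

theorem dwt_runner_congr (hB : IsMaya B) {b c : ℤ} (h : (b : ZMod s) = c) :
    dwt (runner s B b) = dwt (runner s B c) := by
  rw [dwt_runner hB, dwt_runner hB, frame_congr hB h]

theorem dweight_fold (hB : IsMaya B) (hne : (a : ZMod s) ≠ a + t) :
    dweight s B = dweight s (fold s t B a) +
      2 * ((msum 1 (runner s B a ∪ runner s B (a + t)) - msum 1 (runner s B a)) *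
        (msum 1 (runner s B a ∪ runner s B (a + t)) - msum 1 (runner s B (a + t)))) := by
  have hA := isMaya_fold hB hne
  set A := fold s t B a
  have h1 : ∀ i : ZMod s, dwt (runner s B i.val) = dwt (runner s A i.val) +
      (if i = (a : ZMod s) then dwt (runner s B a) - dwt (runner s A a) else 0) +
      (if i = (a + t : ZMod s) then dwt (runner s B (a + t)) - dwt (runner s A (a + t))
        else 0) := by
    intro i
    have hv : ((i.val : ℤ) : ZMod s) = i := intCast_val i
    by_cases hi : i = a
    · have hj : i ≠ a + t := hi ▸ hne
      rw [if_pos hi, if_neg hj, dwt_runner_congr hB (hv.trans hi),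
        dwt_runner_congr hA (hv.trans hi)]
      ring
    · rw [if_neg hi]
      by_cases hj : i = a + t
      · have hj' : i = ((a + t : ℤ) : ZMod s) := by simpa using hj
        rw [if_pos hj, dwt_runner_congr hB (hv.trans hj'), dwt_runner_congr hA (hv.trans hj')]
        ring
      · rw [if_neg hj, runner_fold_other (by rwa [hv]) (by rwa [hv])]
        ring
  rw [dweight, Finset.sum_congr rfl fun i _ => h1 i, Finset.sum_add_distrib,
    Finset.sum_add_distrib, Finset.sum_ite_eq' Finset.univ, Finset.sum_ite_eq' Finset.univ,
    if_pos (Finset.mem_univ _), if_pos (Finset.mem_univ _), runner_fold_left hne,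
    runner_fold_right hne, dweight]
  have := dwt_union_add_inter (isMaya_runner (s := s) hB a) (isMaya_runner (s := s) hB (a + t))
  linarith

theorem dweight_fold_le (hB : IsMaya B) (hne : (a : ZMod s) ≠ a + t) :
    dweight s (fold s t B a) ≤ dweight s B := by
  have hX := isMaya_runner (s := s) hB a
  have hY := isMaya_runner (s := s) hB (a + t)
  rw [dweight_fold hB hne]
  have h1 := msum_le_of_subset hX (hX.union hY) Set.subset_union_left
  have h2 := msum_le_of_subset hY (hX.union hY) Set.subset_union_right
  have := mul_nonneg (sub_nonneg.2 h1) (sub_nonneg.2 h2)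
  linarith

/-- Equal weights force the two runners to be nested, and a moved bead decides which contains the
other; the fold is then an exchange of the two runners. -/
theorem elt_frame_fold (hB : IsMaya B) (hne : (a : ZMod s) ≠ a + t)
    (h : (foldTargets s t B a).Nonempty) (hw : dweight s (fold s t B a) = dweight s B)
    (i : ZMod s) :
    (elt s (fold s t B a) i.val : ZMod t) = elt s B (Equiv.swap (a : ZMod s) (a + t) i).val ∧
      frame s (fold s t B a) i.val = frame s B (Equiv.swap (a : ZMod s) (a + t) i).val := by
  have hX := isMaya_runner (s := s) hB a
  have hY := isMaya_runner (s := s) hB (a + t)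
  rw [dweight_fold hB hne, left_eq_add, mul_eq_zero, or_iff_right two_ne_zero, mul_eq_zero,
    sub_eq_zero, sub_eq_zero] at hw
  have hsub : runner s B a ⊆ runner s B (a + t) := by
    rcases hw with hw | hw
    · have h1 := eq_of_subset_of_msum_eq hX (hX.union hY) Set.subset_union_left hw
      obtain ⟨y, hy, hyB, hytB⟩ := h
      obtain ⟨k, rfl⟩ := exists_eq_add_mul hy.symm
      have h2 : k ∈ runner s B (a + t) := by
        rw [runner, Set.mem_ofPred_eq, add_right_comm]
        exact hytB
      have h3 : k ∈ runner s B a := h1 ▸ Or.inr h2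
      exact absurd h3 hyB
    · rw [eq_of_subset_of_msum_eq hY (hX.union hY) Set.subset_union_right hw]
      exact Set.subset_union_left
  have hup : ∀ x : ℤ, (x : ZMod s) = a → x ∈ B → x + t ∈ B := by
    intro x hx hxB
    obtain ⟨k, rfl⟩ := exists_eq_add_mul hx.symm
    have h2 : k ∈ runner s B (a + t) := hsub hxB
    rwa [runner, Set.mem_ofPred_eq, add_right_comm] at h2
  refine elt_frame_of_displacement hB
    (d := fun i => if i = (a : ZMod s) then (t : ℤ) else
      if i = (a + t : ZMod s) then -(t : ℤ) else 0) (fun x => ?_)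
    (fun i => ?_) (fun i => ?_) i
  · by_cases h1 : (x : ZMod s) = a
    · rw [mem_fold_left hne h1, if_pos h1]
      exact ⟨fun h => h.elim (hup x h1) id, Or.inr⟩
    · rw [if_neg h1]
      by_cases h2 : (x : ZMod s) = a + t
      · rw [mem_fold_right hne h2, if_pos h2, ← sub_eq_add_neg]
        refine ⟨fun h => h.2, fun h => ⟨?_, h⟩⟩
        have := hup (x - t) (by simp [h2]) h
        rwa [sub_add_cancel] at this
      · rw [mem_fold_other h1 h2, if_neg h2, add_zero]
  · split_ifs <;> simp
  · rw [Equiv.swap_apply_def]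
    split_ifs with h1 h2
    · rw [h1]; simp
    · rw [h2]; simp
    · simp

end Fold

/-! ### Folding down to the `t`-core. -/

theorem msum_id_nonneg (B : Set ℤ) : 0 ≤ msum id B :=
  finsum_nonneg fun x => by
    by_cases h1 : x ∈ B <;> by_cases h2 : x < 0 <;> simp [ind, h1, h2] <;> omega

section Chain

variable {s t : ℕ} [NeZero s] [NeZero t]

/-- Induction on `msum id`: as long as the beta-set is not closed under subtraction of `t`, some
fold moves a bead while fixing the `t`-core. The assumption on `t` keeps the two folded classes
distinct. -/
theorem dweight_core_le_and_weightedQuotient_core (hst : (t : ZMod s) ≠ 0) (mu : YoungDiagram) :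
    dweight s (beta 0 (core t mu)) ≤ dweight s (beta 0 mu) ∧
      (dweight s (beta 0 (core t mu)) = dweight s (beta 0 mu) →
        weightedQuotient s t (core t mu) = weightedQuotient s t mu) := by
  induction hn : (msum id (beta 0 mu)).toNat using Nat.strong_induction_on generalizing mu with
  | _ n ih =>
    by_cases hc : ∀ b ∈ beta 0 mu, b - t ∈ beta 0 mu
    · rw [core_eq_of_closed hc]
      exact ⟨le_rfl, fun _ => rfl⟩
    · push Not at hc
      obtain ⟨b, hb, hbt⟩ := hc
      have hB := isMaya_beta mu
      have hne : ((b - t : ℤ) : ZMod s) ≠ (b - t : ℤ) + t := by simpa using hst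
      have hT : (foldTargets s t (beta 0 mu) (b - t)).Nonempty :=
        ⟨b - t, rfl, hbt, by rwa [sub_add_cancel]⟩
      obtain ⟨nu, hnu⟩ := exists_beta_zero (isMaya_fold hB hne) (by
        rw [msum_fold_of_periodic hB hne fun _ => rfl, msum_one_beta_zero])
      have hcore : core t nu = core t mu := core_eq_of_msum_eq fun f hf => by
        rw [hnu, msum_fold_of_periodic hB hne hf]
      have hlt := msum_id_fold_lt hB hne (Nat.pos_of_ne_zero (NeZero.ne t)) hT
      have hle := dweight_fold_le (s := s) (t := t) hB hne
      have h0 := msum_id_nonneg (fold s t (beta 0 mu) (b - t))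
      obtain ⟨h1, h2⟩ := ih _ (by rw [← hn, hnu]; omega) nu rfl
      rw [hcore, hnu] at h1
      rw [hcore, hnu] at h2
      -- Equality at the two ends squeezes the weight of the intermediate partition `nu`, so both
      -- stages preserve the weighted quotient.
      refine ⟨h1.trans hle, fun h => (h2 (le_antisymm h1 (h ▸ hle))).trans ?_⟩
      refine (weightedQuotient_eq_iff t).2 
        ⟨Equiv.swap ((b - t : ℤ) : ZMod s) ((b - t : ℤ) + t), fun i => ?_⟩
      rw [hnu]
      exact elt_frame_fold hB hne hT (le_antisymm hle (h ▸ h1)) i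

theorem core_one_eq (la mu : YoungDiagram) : core 1 la = core 1 mu := by
  have h : ∀ la, beta 0 (core 1 la) = Set.Iio 0 := fun la => by
    have h1 := eq_Iio_of_closed (isMaya_beta _)
      (by simpa using ((core_spec 1 la).2).sub_mem one_pos)
    rwa [msum_one_beta_zero] at h1
  exact beta_zero_injective ((h la).trans (h mu).symm)

theorem core_eq_self_of_card_eq {mu : YoungDiagram} (h : (core t mu).card = mu.card) :
    core t mu = mu := by
  rcases (core_spec t mu).1.cases_head with h1 | ⟨nu, h1, h2⟩
  · exact h1.symm
  · obtain ⟨n, h3, -⟩ := exists_number_of_hooks h2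
    have := card_of_removeHook h1
    have := Nat.pos_of_ne_zero (NeZero.ne t)
    omega

/-- An `[s:t]`-core has the same `t`-weighted `s`-quotient as its `t`-core. -/
theorem IsGenCore.weightedQuotient_core (hst : Nat.Coprime s t) {mu : YoungDiagram}
    (h : IsGenCore s t mu) : weightedQuotient s t (core t mu) = weightedQuotient s t mu := by
  by_cases hs : s = 1
  -- With one runner there is nothing to fold. All 1-cores coincide, so equal 1-weights mean equal
  -- sizes, and the partition is its own `t`-core.
  · subst hs
    have h1 := (card_eq_and_dweight_eq (s := 1) mu).1
    have h2 := (card_eq_and_dweight_eq (s := 1) (core t mu)).1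
    rw [core_one_eq _ mu, show weight 1 (core t mu) = weight 1 mu from h, ← h1] at h2
    rw [core_eq_self_of_card_eq h2]
  · refine (dweight_core_le_and_weightedQuotient_core (fun h0 => hs ?_) mu).2
      (dweight_eq_iff.2 h)
    exact hst.eq_one_of_dvd ((ZMod.natCast_eq_zero_iff t s).1 h0)

end Chain

/-! ### Consequences of equal weighted quotients; uniqueness. -/

theorem weight_eq_of_weightedQuotient_eq {s t : ℕ} [NeZero s] {la mu : YoungDiagram}
    (h : weightedQuotient s t la = weightedQuotient s t mu) : weight s la = weight s mu := by
  obtain ⟨e, he⟩ := (weightedQuotient_eq_iff t).1 h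
  exact dweight_eq_iff.1
    (dweight_eq_of_frame_eq (isMaya_beta la) (isMaya_beta mu) e fun i => (he i).2)

/-- In a `t`-core, runners whose markers agree modulo `t` carry the same partition. -/
theorem IsCore.frame_eq {s t : ℕ} [NeZero s] [NeZero t] {ta : YoungDiagram} (h : IsCore t ta)
    {a b : ℤ} (hab : (elt s (beta 0 ta) a : ZMod t) = elt s (beta 0 ta) b) :
    frame s (beta 0 ta) a = frame s (beta 0 ta) b := by
  have hdown : ∀ (n : ℕ) (x : ℤ), x + t * n ∈ beta 0 ta → x ∈ beta 0 ta := by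
    intro n
    induction n with
    | zero => intro x hx; simpa using hx
    | succ n ih =>
      intro x hx
      refine ih x ?_
      have := h.closed _ hx
      rwa [show x + t * ((n + 1 : ℕ) : ℤ) - t = x + t * n by push_cast; ring] at this
  have hB := isMaya_beta ta
  have key : ∀ (a b : ℤ) (n : ℕ), elt s (beta 0 ta) b = elt s (beta 0 ta) a + t * n →
      frame s (beta 0 ta) b = frame s (beta 0 ta) a := by
    intro a b n hn
    -- Descending by `t * n` embeds the frame at the higher marker in the other one; both have
    -- charge zero, so they are equal.
    refine eq_of_subset_of_msum_eq (isMaya_frame hB b) (isMaya_frame hB a) (fun x hx => ?_)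
      (by rw [msum_one_frame hB, msum_one_frame hB])
    refine hdown n _ ?_
    rw [add_right_comm, ← hn]
    exact hx
  obtain ⟨k, hk⟩ := exists_eq_add_mul hab
  rcases le_total 0 k with h0 | h0
  · lift k to ℕ using h0
    exact (key a b k hk).symm
  · exact key b a (-k).toNat (by rw [Int.toNat_of_nonneg (by omega)]; linarith)

theorem eq_of_core_eq_of_weightedQuotient_eq {s t : ℕ} [NeZero s] [NeZero t]
    {ta la mu : YoungDiagram} (hta : IsCore t ta) (hc : core s mu = core s la)
    (hla : weightedQuotient s t la = weightedQuotient s t ta)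
    (hmu : weightedQuotient s t mu = weightedQuotient s t ta) : mu = la := by
  obtain ⟨e, he⟩ := (weightedQuotient_eq_iff t).1 hla
  obtain ⟨f, hf⟩ := (weightedQuotient_eq_iff t).1 hmu
  have h1 := elt_eq_of_core_eq hc
  refine beta_zero_injective (eq_of_elt_of_frame (s := s) (isMaya_beta mu) (isMaya_beta la)
    (fun i => h1 _) fun i => ?_)
  -- The permutations `e` and `f` may differ, but both send `i` to runners of `ta` whose markers are
  -- congruent modulo `t`.
  rw [(he i).2, (hf i).2]
  exact hta.frame_eq (by rw [← (he i).1, ← (hf i).1, h1])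

/-! ### Existence by pulling back along a displacement of runners. -/

/-- Reindexing along a permutation of the integers that fixes residue classes modulo `t`. -/
theorem msum_sub_msum_of_equiv {A A' B B' : Set ℤ} (hA : IsMaya A) (hA' : IsMaya A')
    (hB : IsMaya B) (hB' : IsMaya B') (φ : ℤ ≃ ℤ) (h : ∀ x, x ∈ A ↔ φ x ∈ B)
    (h' : ∀ x, x ∈ A' ↔ φ x ∈ B') {f : ℤ → ℤ} (hf : ∀ x, f (φ x) = f x) :
    msum f A - msum f A' = msum f B - msum f B' := by
  rw [msum_sub_msum hA hA', msum_sub_msum hB hB',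
    ← finsum_comp_equiv φ (f := fun x => (ind B x - ind B' x) * f x)]
  exact finsum_congr fun x => by rw [ind_congr (h x), ind_congr (h' x), hf]

theorem periodic_eq_of_intCast_eq {t : ℕ} {f : ℤ → ℤ} (hf : ∀ x, f (x - t) = f x) {x y : ℤ}
    (h : (x : ZMod t) = y) : f x = f y := by
  have hp : Function.Periodic f (t : ℤ) := fun x => by rw [← hf (x + t), add_sub_cancel_right]
  obtain ⟨k, rfl⟩ := exists_eq_add_mul h
  simpa [mul_comm] using (hp.int_mul k x).symm

/-- The permutation of the integers that displaces the residue classes modulo `s` by `d`. -/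
def displace {s : ℕ} (d : ZMod s → ℤ) (e : Equiv.Perm (ZMod s)) (he : ∀ i, i + d i = e i) :
    ℤ ≃ ℤ where
  toFun x := x + d x
  invFun y := y - d (e.symm y)
  left_inv x := by
    have h : ((x + d x : ℤ) : ZMod s) = e x := by push_cast; exact he _
    simp only [h, Equiv.symm_apply_apply, add_sub_cancel_right]
  right_inv y := by
    have h : ((y - d (e.symm y) : ℤ) : ZMod s) = e.symm y := by
      push_cast
      rw [sub_eq_iff_eq_add, he, Equiv.apply_symm_apply]
    simp only [h, sub_add_cancel]

/-- Existence of a partition with prescribed `s`-core and weighted quotient. -/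
theorem exists_core_eq_weightedQuotient_eq {s t : ℕ} [NeZero s] [NeZero t]
    (hst : Nat.Coprime s t) {σ τ : YoungDiagram} (hσ : IsCore s σ)
    (hcore : core t σ = core s τ) :
    ∃ la, core s la = σ ∧ weightedQuotient s t la = weightedQuotient s t τ ∧
      core t la = core t τ := by
  set ka := core s τ with hka
  have hkac : IsCore s ka := (core_spec s τ).2
  -- Both `σ` and its `t`-core `ka` are `s`-cores, hence of `s`-weight zero.
  have hgen : IsGenCore s t σ := by
    rw [IsGenCore, hcore, ← dweight_eq_iff, dweight_of_closed (isMaya_beta _) hσ.closed,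
      dweight_of_closed (isMaya_beta _) hkac.closed]
  obtain ⟨e, he⟩ := (weightedQuotient_eq_iff t).1 (hgen.weightedQuotient_core hst).symm
  rw [hcore] at he
  -- The displacement takes the marker of `σ` at `i` to that of `ka` at `e i`.
  let d : ZMod s → ℤ := fun i => elt s (beta 0 ka) (e i).val - elt s (beta 0 σ) i.val
  have hd : ∀ i, (d i : ZMod t) = 0 := fun i => by
    rw [Int.cast_sub, (he i).1, sub_self]
  have hde : ∀ i, i + d i = e i := fun i => by
    rw [Int.cast_sub, intCast_elt, intCast_elt, intCast_val, intCast_val, add_sub_cancel]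
  let φ := displace d e hde
  have hφ : ∀ x : ℤ, φ x = x + d x := fun _ => rfl
  have hφs : ∀ x : ℤ, (φ x : ZMod s) = e x := fun x => by
    rw [hφ, Int.cast_add, hde]
  have hA : IsMaya (φ ⁻¹' beta 0 τ) := by
    refine (isMaya_beta τ).of_displacement (∑ i, |d i|) fun x => ⟨φ x, φ x, ?_, ?_, id, id⟩ <;>
    · rw [hφ, add_sub_cancel_left]
      exact Finset.single_le_sum (f := fun i => |d i|) (fun i _ => abs_nonneg _)
        (Finset.mem_univ _)
  have hval : ∀ (B : Set ℤ), IsMaya B → ∀ (x : ℤ) (i : ZMod s), (x : ZMod s) = i →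
      elt s B x = elt s B i.val := fun B hB x i hx => elt_congr hB (by rw [intCast_val, hx])
  have hσka : ∀ x, x ∈ beta 0 σ ↔ φ x ∈ beta 0 ka := fun x => by
    rw [mem_iff_lt_elt (isMaya_beta σ) hσ.closed, mem_iff_lt_elt (isMaya_beta ka) hkac.closed,
      hval _ (isMaya_beta σ) x x rfl, hval _ (isMaya_beta ka) _ _ (hφs x), hφ]
    simp only [d]
    omega
  have hper : ∀ f : ℤ → ℤ, (∀ x, f (x - t) = f x) →
      msum f (φ ⁻¹' beta 0 τ) = msum f (beta 0 τ) := by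
    intro f hf
    -- The pullback differs from `σ` as `τ` differs from `ka`, and `σ` and `ka` have equal
    -- `t`-periodic sums because `ka` is the `t`-core of `σ`.
    have h1 := msum_sub_msum_of_equiv hA (isMaya_beta σ) (isMaya_beta τ) (isMaya_beta ka) φ
      (fun _ => Iff.rfl) hσka (f := f) fun x => periodic_eq_of_intCast_eq hf (by
        rw [hφ, Int.cast_add, hd, add_zero])
    have h2 := msum_core σ hf
    rw [hcore] at h2
    linarith
  obtain ⟨la, hla⟩ := exists_beta_zero hA (by rw [hper _ fun _ => rfl, msum_one_beta_zero])
  have hmem : ∀ x : ℤ, x ∈ beta 0 la ↔ x + d x ∈ beta 0 τ := fun x => by rw [hla]; rfl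
  refine ⟨la, ?_, ?_, ?_⟩
  · rw [← hσ.core_eq]
    refine core_eq_of_elt_eq fun a => ?_
    rw [elt_of_displacement hmem, ← hφ, ← elt_core, ← hka,
      hval _ (isMaya_beta ka) _ _ (hφs a), hval _ (isMaya_beta σ) a a rfl]
    simp only [d]
    ring
  · exact (weightedQuotient_eq_iff t).2
      ⟨e, elt_frame_of_displacement (isMaya_beta τ) hmem hd hde⟩
  · exact core_eq_of_msum_eq fun f hf => by rw [hla, hper f hf]

end GenCore

end

theorem mainTheorem10 (s t : ℕ) [NeZero s] [NeZero t] (hst : Nat.Coprime s t)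
    (σ τ : YoungDiagram) (hσ : GenCore.IsCore s σ) (hτ : GenCore.IsCore t τ)
    (hcore : GenCore.core t σ = GenCore.core s τ) :
    ∃ la : YoungDiagram,
      (GenCore.core s la = σ ∧
        GenCore.weightedQuotient s t la = GenCore.weightedQuotient s t τ) ∧
      (∀ mu : YoungDiagram, GenCore.core s mu = σ →
        GenCore.weightedQuotient s t mu = GenCore.weightedQuotient s t τ → mu = la) ∧
      GenCore.IsBoxplus s t σ τ la := by
  obtain ⟨la, h1, h2, h3⟩ := GenCore.exists_core_eq_weightedQuotient_eq hst hσ hcore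
  rw [hτ.core_eq] at h3
  have huniq : ∀ mu : YoungDiagram, GenCore.core s mu = σ →
      GenCore.weightedQuotient s t mu = GenCore.weightedQuotient s t τ → mu = la :=
    fun mu hmu hq => GenCore.eq_of_core_eq_of_weightedQuotient_eq hτ (hmu.trans h1.symm) h2 hq
  refine ⟨la, ⟨h1, h2⟩, huniq, ⟨⟨?_, h1, h3⟩, fun mu hgen hmu hmut => huniq mu hmu ?_⟩⟩
  · rw [GenCore.IsGenCore, h3]
    exact (GenCore.weight_eq_of_weightedQuotient_eq h2).symm
  · rw [← hgen.weightedQuotient_core hst, hmut]
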